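/- Let $K$ be a field, let $G$ be a finite simple graph with vertex set $V$ and at least one edge, and let $R=K[x_v : v\in V]$ with the standard grading. Let $I(G)=(x_ux_v : \{u,v\}\text{ an edge of }G)\subseteq R$ be the edge ideal of $G$. Let $G^c$ be the complement of $G$: the graph on $V$ in which two distinct vertices are adjacent if and only if they are not adjacent in $G$. A graph is called chordal if it has no induced cycle of length at least $4$. For a finitely generated graded $R$-module $M$ with minimal graded free resolution $$\cdots\to\bigoplus_{j}R(-j)^{\beta_{1j}(M)}\to\bigoplus_{j}R(-j)^{\beta_{0j}(M)}\to M\to 0,$$ its Castelnuovo--Mumford regularity is $\operatorname{reg}(M)=\max\{j-i : \beta_{ij}(M)\neq 0\}$. Theorem (Fröberg, Wegner). $\operatorname{reg}(I(G))=2$ if and only if $G^c$ is chordal. -/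

import Mathlib

open MvPolynomial

/-- A graph is chordal if it has no induced cycle of length at least `4`. -/
def SimpleGraph.IsChordalGraph {V : Type*} (G : SimpleGraph V) : Prop :=
  ∀ n : ℕ, 4 ≤ n → ¬ (SimpleGraph.cycleGraph n).IsIndContained G

/-- The edge ideal `I(G) = (x_u x_v | {u, v} an edge of G)` in the polynomial ring `K[x_v | v ∈ V]`. -/
noncomputable def SimpleGraph.edgeIdeal (K : Type*) [Field K] {V : Type*} (G : SimpleGraph V) :
    Ideal (MvPolynomial V K) :=
  Ideal.span {p | ∃ u v : V, G.Adj u v ∧ p = X u * X v}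

/-- The degree `l` part of the polynomial ring in its standard grading, extended by `0` to negative
degrees. Thus `polyPart K V (l - j)` is the degree `l` part of the twist `R(-j)`. -/
noncomputable def polyPart (K : Type*) [Field K] (V : Type*) (l : ℤ) : Submodule K (MvPolynomial V K) :=
  if 0 ≤ l then homogeneousSubmodule V K l.toNat else ⊥

/-- The degree `l` part `I ∩ R_l` of a homogeneous ideal `I` of the polynomial ring `R`. -/
noncomputable def idealPart {K : Type*} [Field K] {V : Type*} (I : Ideal (MvPolynomial V K)) (l : ℤ) :
    Submodule K I :=
  (polyPart K V l).comap (I.subtype.restrictScalars K)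

/-- A minimal graded free resolution
`⋯ → F₂ → F₁ → F₀ → M → 0` of a graded module `M = ⨁ l, ℳ l` over `R = K[x_v | v ∈ V]`.
Here `F i = ⨁ a, R(-deg i a)` is free of finite rank `rank i`, with standard basis vectors
`Pi.single a 1` placed in degrees `deg i a`. -/
structure MinimalGradedFreeResolution {K : Type*} [Field K] {V : Type*} {M : Type*}
    [AddCommGroup M] [Module K M] [Module (MvPolynomial V K) M] (ℳ : ℤ → Submodule K M) where
  /-- the rank of the free module in homological degree `i` -/
  rank : ℕ → ℕ
  /-- the internal degrees of the basis elements -/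
  deg : (i : ℕ) → Fin (rank i) → ℤ
  /-- the differentials -/
  d : (i : ℕ) →
    (Fin (rank (i + 1)) → MvPolynomial V K) →ₗ[MvPolynomial V K] (Fin (rank i) → MvPolynomial V K)
  /-- the augmentation -/
  aug : (Fin (rank 0) → MvPolynomial V K) →ₗ[MvPolynomial V K] M
  /-- the augmentation is homogeneous of degree `0` -/
  aug_homogeneous : ∀ a, aug (Pi.single a 1) ∈ ℳ (deg 0 a)
  /-- the differentials are homogeneous of degree `0` -/
  d_homogeneous : ∀ i b a, d i (Pi.single b 1) a ∈ polyPart K V (deg (i + 1) b - deg i a)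
  aug_surjective : Function.Surjective aug
  exact_zero : Function.Exact (d 0) aug
  exact_succ : ∀ i, Function.Exact (d (i + 1)) (d i)
  /-- minimality: the image of each differential lies in `𝔪 F`, with `𝔪 = (x_v | v ∈ V)` -/
  minimal : ∀ i b a, d i (Pi.single b 1) a ∈
    Ideal.span (Set.range (X : V → MvPolynomial V K))

/-- The exponent `β i j` of `R(-j)` in homological degree `i` of the resolution. -/
def MinimalGradedFreeResolution.betti {K : Type*} [Field K] {V : Type*} {M : Type*}
    [AddCommGroup M] [Module K M] [Module (MvPolynomial V K) M] {ℳ : ℤ → Submodule K M}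
    (F : MinimalGradedFreeResolution (V := V) ℳ) (i : ℕ) (j : ℤ) : ℕ :=
  (Finset.univ.filter fun a => F.deg i a = j).card

/-- The Castelnuovo–Mumford regularity `max {j - i | β i j ≠ 0}` of a finitely generated graded
module `M = ⨁ l, ℳ l` over `K[x_v | v ∈ V]`, the `β i j` being read off from a minimal graded free
resolution (which exists and is unique up to isomorphism, so that it does not matter which one is
used). It is `⊥`, that is `-∞`, for the zero module. -/
noncomputable def regularity {K : Type*} [Field K] (V : Type*) {M : Type*}
    [AddCommGroup M] [Module K M] [Module (MvPolynomial V K) M] (ℳ : ℤ → Submodule K M) :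
    WithBot (WithTop ℤ) :=
  sSup {r | ∃ (F : MinimalGradedFreeResolution (V := V) ℳ) (i : ℕ) (j : ℤ),
    F.betti i j ≠ 0 ∧ r = ((j - i : ℤ) : WithTop ℤ)}

/-! The proof replaces Betti numbers by Koszul homology. A chain of the Koszul complex of the
variables with coefficients in an ideal `I` is a function on subsets `S` of `V`; its homology at
`|S| = i` in coefficient degree `d` is the part of `Tor_i(I, K)` of degree `d + i`. So all shifts of
a minimal resolution satisfy `j - i ≤ r` exactly when this homology vanishes in coefficient degrees
above `r`, which is `KoszulVanishing`. The equivalence is proved directly, without Tor: vanishing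
climbs from a module to its syzygies (`koszulVanishing_ker`) and descends from the syzygies
(`koszulVanishingBelow_range`), because free modules are Koszul-acyclic in high degrees; minimality
makes each generator visible in homological degree zero (`deg_le_of_koszulVanishing`).

If the complement is chordal, Dirac's theorem gives a vertex `v` whose neighbours in the complement
form a clique. Then `I(G) = x_v P + J`, where `P` is generated by the `G`-neighbours of `v` and `J =
I(G - v)` lies in `P`. The exact sequence `0 → J(-1) → P(-1) ⊕ J → I → 0` gives vanishing above 2 by
induction (`koszulVanishing_of_decomposition`). Generators have degree at least 2, so the regularity
is exactly 2.

If the complement has an induced cycle of length at least 4, an explicit Koszul cycle of coefficient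
degree 3 does not bound (`not_koszulVanishing_of_cycle`). It reflects the first homology of that
cycle: a boundary would give a potential on its vertices that is constant along every edge but one,
yet jumps across that one. -/

/-- The projection of the polynomial ring onto its part of degree `d`. -/
noncomputable def polyProj (K : Type*) [Field K] (V : Type*) (d : ℤ) :
    MvPolynomial V K →ₗ[K] MvPolynomial V K :=
  if 0 ≤ d then homogeneousComponent d.toNat else 0

/-! ### Homogeneous components of polynomials -/

section PolyProj

variable {K : Type*} [Field K] {V : Type*}

theorem coeff_polyProj (d : ℤ) (p : MvPolynomial V K) (m : V →₀ ℕ) :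
    coeff m (polyProj K V d p) = if (m.degree : ℤ) = d then coeff m p else 0 := by
  unfold polyProj
  split_ifs with h1 h2 h2
  · rw [coeff_homogeneousComponent, if_pos (by omega)]
  · rw [coeff_homogeneousComponent, if_neg (by omega)]
  · omega
  · simp

theorem polyProj_polyProj (d e : ℤ) (p : MvPolynomial V K) :
    polyProj K V d (polyProj K V e p) = if d = e then polyProj K V e p else 0 := by
  ext m
  split_ifs with h
  · simp only [coeff_polyProj]
    grind
  · simp only [coeff_polyProj, coeff_zero]
    grind

theorem polyProj_monomial (d : ℤ) (s : V →₀ ℕ) (a : K) :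
    polyProj K V d (monomial s a) = if (s.degree : ℤ) = d then monomial s a else 0 := by
  ext m
  classical
  split_ifs with h
  · simp only [coeff_polyProj, coeff_monomial]
    grind
  · simp only [coeff_polyProj, coeff_monomial, coeff_zero]
    grind

theorem polyProj_monomial_mul (d : ℤ) (s : V →₀ ℕ) (a : K) (p : MvPolynomial V K) :
    polyProj K V d (monomial s a * p) = monomial s a * polyProj K V (d - s.degree) p := by
  ext m
  classical
  simp only [coeff_polyProj, coeff_monomial_mul']
  by_cases hs : s ≤ m
  · have : m.degree = (m - s).degree + s.degree := by
      rw [← map_add, tsub_add_cancel_of_le hs]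
    simp only [hs, if_true, this]
    push_cast
    simp only [eq_sub_iff_add_eq]
    split_ifs <;> simp
  · simp [hs]

theorem polyProj_X_mul (d : ℤ) (v : V) (p : MvPolynomial V K) :
    polyProj K V (d + 1) (X v * p) = X v * polyProj K V d p := by
  rw [X, polyProj_monomial_mul]
  simp

theorem polyProj_mul_of_eq {d k : ℤ} {q : MvPolynomial V K} (hq : polyProj K V k q = q)
    (p : MvPolynomial V K) :
    polyProj K V d (p * q) = polyProj K V (d - k) p * q := by
  induction p using MvPolynomial.induction_on' with
  | monomial s a =>
    rw [polyProj_monomial_mul, polyProj_monomial]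
    nth_rw 1 [← hq]
    rw [polyProj_polyProj]
    split_ifs with h1 h2 h2
    · rw [hq]
    · omega
    · omega
    · simp
  | add p p' ih ih' => rw [add_mul, map_add, map_add, ih, ih', add_mul]

theorem exists_sum_polyProj (p : MvPolynomial V K) (D : Finset ℤ) :
    ∃ E : Finset ℤ, D ⊆ E ∧ ∀ E', E ⊆ E' → p = ∑ d ∈ E', polyProj K V d p := by
  classical
  refine ⟨D ∪ p.support.image (fun m => (m.degree : ℤ)), Finset.subset_union_left, fun E' h => ?_⟩
  ext m
  rw [coeff_sum]
  simp only [coeff_polyProj]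
  rw [Finset.sum_ite_eq]
  split_ifs with hm
  · rfl
  · by_contra h0
    apply hm
    apply h
    apply Finset.mem_union_right
    exact Finset.mem_image_of_mem _ (mem_support_iff.2 h0)

theorem mem_polyPart_iff (l : ℤ) (p : MvPolynomial V K) :
    p ∈ polyPart K V l ↔ polyProj K V l p = p := by
  unfold polyPart polyProj
  split_ifs with h
  · rw [mem_homogeneousSubmodule]
    constructor
    · intro hp
      exact homogeneousComponent_eq_self hp
    · intro hp
      rw [← hp]
      exact homogeneousComponent_isHomogeneous _ _
  · simp [eq_comm]

end PolyProj

/-- A `ℤ`-grading of a module over the polynomial ring, given by the projections onto its parts. -/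
structure DegreeProjection (K : Type*) [Field K] (V : Type*) (M : Type*) [AddCommGroup M]
    [Module (MvPolynomial V K) M] where
  /-- the projection onto the part of degree `d` -/
  proj : ℤ → M →+ M
  proj_proj : ∀ d m, proj d (proj d m) = proj d m
  proj_X_smul : ∀ d v m, proj (d + 1) ((X v : MvPolynomial V K) • m) =
    (X v : MvPolynomial V K) • proj d m
  proj_smul : ∀ d k (p : MvPolynomial V K) m, proj k m = m →
    proj d (p • m) = polyProj K V (d - k) p • m
  exists_sum : ∀ m, ∃ D : Finset ℤ, m = ∑ d ∈ D, proj d m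

/-- The standard grading of the polynomial ring. -/
noncomputable def DegreeProjection.poly (K : Type*) [Field K] (V : Type*) :
    DegreeProjection K V (MvPolynomial V K) where
  proj d := (polyProj K V d).toAddMonoidHom
  proj_proj d m := by simp [polyProj_polyProj]
  proj_X_smul d v m := polyProj_X_mul d v m
  proj_smul d k p m h := polyProj_mul_of_eq h p
  exists_sum m := by
    obtain ⟨E, -, h⟩ := exists_sum_polyProj m ∅
    exact ⟨E, h E subset_rfl⟩

@[simp]
theorem DegreeProjection.poly_proj {K : Type*} [Field K] {V : Type*} (d : ℤ)
    (p : MvPolynomial V K) : (DegreeProjection.poly K V).proj d p = polyProj K V d p := rfl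

/-- The grading of a free module of finite rank whose basis elements are placed in degrees `deg`. -/
noncomputable def DegreeProjection.free (K : Type*) [Field K] (V : Type*) {ι : Type*} [Finite ι]
    (deg : ι → ℤ) : DegreeProjection K V (ι → MvPolynomial V K) where
  proj d := AddMonoidHom.mk' (fun f a => polyProj K V (d - deg a) (f a))
    (fun f g => by ext1 a; simp)
  proj_proj d f := by ext1 a; simp [polyProj_polyProj]
  proj_X_smul d v f := by
    ext1 a
    simp only [AddMonoidHom.mk'_apply, Pi.smul_apply, smul_eq_mul]
    rw [← polyProj_X_mul, sub_add_eq_add_sub]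
  proj_smul d k p f h := by
    ext1 a
    have := congrFun h a
    simp only [AddMonoidHom.mk'_apply] at this
    simp only [AddMonoidHom.mk'_apply, Pi.smul_apply, smul_eq_mul]
    rw [polyProj_mul_of_eq this, sub_sub_sub_cancel_right]
  exists_sum f := by
    classical
    have := Fintype.ofFinite ι
    choose E _ h using fun a => exists_sum_polyProj (f a) ∅
    refine ⟨Finset.univ.biUnion fun a => (E a).image (· + deg a), ?_⟩
    ext1 a
    rw [Finset.sum_apply]
    simp only [AddMonoidHom.mk'_apply]
    conv_lhs => rw [h a ((Finset.univ.biUnion fun a => (E a).image (· + deg a)).image (· - deg a))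
      (by
        intro e he
        simp only [Finset.mem_image, Finset.mem_biUnion, Finset.mem_univ, true_and]
        exact ⟨e + deg a, ⟨a, e, he, rfl⟩, by ring⟩)]
    rw [Finset.sum_image (fun x _ y _ hxy => by simpa using hxy)]

@[simp]
theorem DegreeProjection.free_proj {K : Type*} [Field K] {V : Type*} {ι : Type*} [Finite ι]
    (deg : ι → ℤ) (d : ℤ) (f : ι → MvPolynomial V K) (a : ι) :
    (DegreeProjection.free K V deg).proj d f a = polyProj K V (d - deg a) (f a) := rfl

/-! ### The Koszul complex of the variables -/

section Koszul

variable {V : Type*} [LinearOrder V]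

/-- The sign with which `v` is moved past the elements of `S` that precede it. -/
def koszulSign (v : V) (S : Finset V) : ℤ := (-1) ^ (S.filter (· < v)).card

theorem koszulSign_mul_self (v : V) (S : Finset V) : koszulSign v S * koszulSign v S = 1 := by
  rw [koszulSign, ← mul_pow]
  simp

theorem koszulSign_insert {v w : V} {S : Finset V} (hv : v ∉ S) :
    koszulSign w (insert v S) = if v < w then -koszulSign w S else koszulSign w S := by
  unfold koszulSign
  rw [Finset.filter_insert]
  split_ifs with h
  · rw [Finset.card_insert_of_notMem (by simp [hv]), pow_succ]
    ring
  · rfl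

theorem koszulSign_mul_insert {v w : V} {S : Finset V} (hv : v ∉ S) (hw : w ∉ S) (hvw : v ≠ w) :
    koszulSign v S * koszulSign w (insert v S) = -(koszulSign w S * koszulSign v (insert w S)) := by
  rw [koszulSign_insert hv, koszulSign_insert hw]
  rcases lt_or_gt_of_ne hvw with h | h
  · rw [if_pos h, if_neg h.not_gt]
    ring
  · rw [if_neg h.not_gt, if_pos h]
    ring

variable [Fintype V] (K : Type*) [Field K] {M : Type*} [AddCommGroup M]
  [Module (MvPolynomial V K) M]

/-- The differential of the Koszul complex of the variables with coefficients in `M`. The chain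
`∑ S, c S ⊗ e_S` is represented by the function `c`. -/
noncomputable def koszulD : (Finset V → M) →ₗ[MvPolynomial V K] (Finset V → M) where
  toFun c S := ∑ v ∈ Sᶜ, koszulSign v S • (X v : MvPolynomial V K) • c (insert v S)
  map_add' c c' := by
    ext1 S
    simp [smul_add, Finset.sum_add_distrib]
  map_smul' p c := by
    ext1 S
    simp only [Pi.smul_apply, RingHom.id_apply, Finset.smul_sum]
    refine Finset.sum_congr rfl fun v _ => ?_
    rw [smul_comm (X v : MvPolynomial V K) p, smul_comm (koszulSign v S) p]

theorem koszulD_apply (c : Finset V → M) (S : Finset V) :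
    koszulD K c S = ∑ v ∈ Sᶜ, koszulSign v S • (X v : MvPolynomial V K) • c (insert v S) := rfl

theorem koszulD_koszulD (c : Finset V → M) : koszulD K (koszulD K c) = 0 := by
  ext1 S
  simp only [koszulD_apply, Finset.smul_sum, Pi.zero_apply]
  rw [Finset.sum_sigma']
  refine Finset.sum_involution (fun p _ => ⟨p.2, p.1⟩) ?_ ?_ ?_ ?_
  · rintro ⟨v, w⟩ h
    simp only [Finset.mem_sigma, Finset.mem_compl, Finset.mem_insert, not_or] at h
    obtain ⟨hv, hwv, hw⟩ := h
    have e : insert v (insert w S) = insert w (insert v S) := Finset.insert_comm _ _ _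
    have h := koszulSign_mul_insert hv hw (Ne.symm hwv)
    simp only [e]
    rw [smul_comm (X v : MvPolynomial V K) (koszulSign w _), smul_smul, h,
      smul_comm (X w : MvPolynomial V K) (koszulSign v _), smul_smul (koszulSign w S),
      smul_comm (X v : MvPolynomial V K) (X w), neg_smul, neg_add_cancel]
  · rintro ⟨v, w⟩ h _
    simp only [Finset.mem_sigma, Finset.mem_compl, Finset.mem_insert, not_or] at h
    intro h'
    simp only [Sigma.mk.injEq] at h'
    exact h.2.1 h'.1
  · rintro ⟨v, w⟩ h
    simp only [Finset.mem_sigma, Finset.mem_compl, Finset.mem_insert, not_or] at h ⊢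
    exact ⟨h.2.2, Ne.symm h.2.1, h.1⟩
  · rintro ⟨v, w⟩ _
    rfl

theorem koszulD_map {M' : Type*} [AddCommGroup M'] [Module (MvPolynomial V K) M']
    (φ : M →ₗ[MvPolynomial V K] M') (c : Finset V → M) :
    koszulD K (fun S => φ (c S)) = fun S => φ (koszulD K c S) := by
  ext1 S
  simp only [koszulD_apply, map_sum, map_zsmul, map_smul]

theorem koszulD_mem {N : Submodule (MvPolynomial V K) M} {c : Finset V → M}
    (h : ∀ S, c S ∈ N) (S : Finset V) : koszulD K c S ∈ N :=
  N.sum_mem fun _ _ => zsmul_mem (N.smul_mem _ (h _)) _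

theorem koszulD_proj (π : DegreeProjection K V M) (d : ℤ) (c : Finset V → M) :
    koszulD K (fun S => π.proj d (c S)) = fun S => π.proj (d + 1) (koszulD K c S) := by
  ext1 S
  simp only [koszulD_apply, map_sum, map_zsmul, π.proj_X_smul]

/-- Left multiplication by `e_v` in the Koszul complex. -/
def koszulWedge {M : Type*} [AddCommGroup M] (v : V) (q : Finset V → M) (S : Finset V) : M :=
  if v ∈ S then koszulSign v (S.erase v) • q (S.erase v) else 0

end Koszul

/-! ### Acyclicity of the Koszul complex of the polynomial ring in positive degrees -/

/-- No monomial of `p` contains the variable `v`. -/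
def VarFree {V K : Type*} [Field K] (v : V) (p : MvPolynomial V K) : Prop :=
  ∀ m : V →₀ ℕ, m v ≠ 0 → coeff m p = 0

section VarFree

variable {K : Type*} [Field K] {V : Type*}

theorem VarFree.zero (v : V) : VarFree v (0 : MvPolynomial V K) := fun m _ => coeff_zero m

theorem VarFree.sum {ι : Type*} {v : V} {s : Finset ι} {p : ι → MvPolynomial V K}
    (h : ∀ i ∈ s, VarFree v (p i)) : VarFree v (∑ i ∈ s, p i) := fun m hm => by
  rw [coeff_sum]
  exact Finset.sum_eq_zero fun i hi => h i hi m hm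

theorem VarFree.zsmul {v : V} {p : MvPolynomial V K} (hp : VarFree v p) (n : ℤ) :
    VarFree v (n • p) := fun m hm => by
  rw [coeff_smul, hp m hm, smul_zero]

theorem VarFree.X_mul {u v : V} {p : MvPolynomial V K} (hp : VarFree v p) (h : u ≠ v) :
    VarFree v (X u * p) := fun m hm => by
  classical
  rw [coeff_X_mul']
  split_ifs
  · apply hp
    simpa [Finsupp.single_apply, h] using hm
  · rfl

theorem eq_zero_of_varFree_X_mul {v : V} {p : MvPolynomial V K} (h : VarFree v (X v * p)) :
    p = 0 := by
  ext m
  have := h (Finsupp.single v 1 + m) (by simp)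
  rwa [coeff_X_mul] at this

theorem varFree_modMonomial (v : V) (p : MvPolynomial V K) :
    VarFree v (p.modMonomial (Finsupp.single v 1)) := fun m hm =>
  coeff_modMonomial_of_le _ (by
    rw [Finsupp.single_le_iff]
    omega)

theorem VarFree.modMonomial {u v : V} {p : MvPolynomial V K} (hp : VarFree u p) :
    VarFree u (p.modMonomial (Finsupp.single v 1)) := fun m hm => by
  by_cases h : Finsupp.single v 1 ≤ m
  · exact coeff_modMonomial_of_le _ h
  · rw [coeff_modMonomial_of_not_le _ h, hp m hm]

end VarFree

section Koszul

variable {V : Type*} [LinearOrder V] [Fintype V] (K : Type*) [Field K]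

theorem koszulD_wedge (v : V) (q : Finset V → MvPolynomial V K) {S : Finset V} (hv : v ∉ S) :
    koszulD K (koszulWedge v q) S = X v * q S := by
  rw [koszulD_apply, Finset.sum_eq_single v]
  · simp only [koszulWedge, Finset.mem_insert_self, if_true, Finset.erase_insert hv]
    rw [smul_comm (X v : MvPolynomial V K), smul_smul, koszulSign_mul_self, one_smul, smul_eq_mul]
  · intro u _ hu
    simp [koszulWedge, hv, Ne.symm hu]
  · simp [hv]

/-- Variables are eliminated one at a time: modulo boundaries, a cycle can be made free of `v` both
in its coefficients and in its exterior part. With `W` all of `V`, only constants are left. -/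
theorem exists_koszulD_sub_varFree {c : Finset V → MvPolynomial V K} (hc : koszulD K c = 0)
    (W : Finset V) : ∃ b : Finset V → MvPolynomial V K,
      ∀ S, ∀ w ∈ W, (w ∈ S → (c - koszulD K b) S = 0) ∧ VarFree w ((c - koszulD K b) S) := by
  induction W using Finset.induction_on with
  | empty => exact ⟨0, by simp⟩
  | insert v W hvW ih =>
    obtain ⟨b, hb⟩ := ih
    set c' := c - koszulD K b with hc'
    have hc'0 : koszulD K c' = 0 := by rw [hc', map_sub, hc, koszulD_koszulD, sub_zero]
    -- The contracting homotopy for `v`: divide by `x_v`, then wedge with `e_v`. For `v ∉ S`,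
    -- subtracting its boundary removes exactly the monomials divisible by `x_v`.
    let q : Finset V → MvPolynomial V K := fun S => (c' S).divMonomial (Finsupp.single v 1)
    set c'' := c' - koszulD K (koszulWedge v q) with hc''
    have hc''0 : koszulD K c'' = 0 := by rw [hc'', map_sub, hc'0, koszulD_koszulD, sub_zero]
    have key : ∀ S, v ∉ S → c'' S = (c' S).modMonomial (Finsupp.single v 1) := by
      intro S hS
      rw [hc'', Pi.sub_apply, koszulD_wedge K v q hS, sub_eq_iff_eq_add]
      exact (modMonomial_add_divMonomial_single _ _).symm
    have key2 : ∀ S, v ∈ S → c'' S = 0 := by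
      intro S hS
      -- The cycle condition at `S.erase v` writes `x_v * c'' S` through values of `c''` at sets
      -- without `v`, which are free of `x_v`.
      apply eq_zero_of_varFree_X_mul (v := v)
      have h := congrFun hc''0 (S.erase v)
      rw [koszulD_apply, Pi.zero_apply, ← Finset.add_sum_erase _ _ (a := v) (by simp),
        Finset.insert_erase hS, add_eq_zero_iff_eq_neg] at h
      have h2 := congrArg (koszulSign v (S.erase v) • ·) h
      simp only [smul_smul, koszulSign_mul_self, one_smul, smul_eq_mul] at h2
      rw [h2, ← neg_one_zsmul, smul_smul]
      refine (VarFree.sum fun u hu => ?_).zsmul _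
      have huv : u ≠ v := (Finset.mem_erase.1 hu).1
      refine (VarFree.X_mul ?_ huv).zsmul _
      rw [key _ (by simp [Ne.symm huv])]
      exact varFree_modMonomial _ _
    refine ⟨b + koszulWedge v q, fun S w hw => ?_⟩
    have e : c - koszulD K (b + koszulWedge v q) = c'' := by
      rw [hc'', hc', map_add, sub_sub]
    rw [e]
    by_cases hS : v ∈ S
    · rw [key2 S hS]
      exact ⟨fun _ => rfl, VarFree.zero w⟩
    · rw [key S hS]
      rcases Finset.mem_insert.1 hw with rfl | hw
      · exact ⟨fun h => absurd h hS, varFree_modMonomial _ _⟩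
      · refine ⟨fun h => ?_, ((hb S w hw).2).modMonomial⟩
        rw [(hb S w hw).1 h]
        simpa using X_mul_modMonomial v (0 : MvPolynomial V K)

theorem exists_koszulD_eq_of_degree_pos {d : ℤ} (hd : 0 < d) {c : Finset V → MvPolynomial V K}
    (hdeg : ∀ S, polyProj K V d (c S) = c S) (hc : koszulD K c = 0) :
    ∃ b, koszulD K b = c := by
  obtain ⟨b, hb⟩ := exists_koszulD_sub_varFree K hc Finset.univ
  refine ⟨fun S => polyProj K V (d - 1) (b S), ?_⟩
  have h1 := koszulD_proj K (DegreeProjection.poly K V) (d - 1) b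
  simp only [DegreeProjection.poly_proj, sub_add_cancel] at h1
  rw [h1]
  ext1 S
  have h2 : polyProj K V d ((c - koszulD K b) S) = 0 := by
    ext m
    rw [coeff_polyProj, coeff_zero]
    split_ifs with hm
    · have : m ≠ 0 := by
        rintro rfl
        simp at hm
        omega
      obtain ⟨w, hw⟩ := Finsupp.ne_iff.1 this
      exact (hb S w (Finset.mem_univ w)).2 m hw
    · rfl
  rw [Pi.sub_apply, map_sub, hdeg, sub_eq_zero] at h2
  exact h2.symm

end Koszul

theorem mem_span_range_X_iff {K : Type*} [Field K] {V : Type*} {p : MvPolynomial V K} :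
    p ∈ Ideal.span (Set.range (X : V → MvPolynomial V K)) ↔ constantCoeff p = 0 := by
  rw [← Set.image_univ, mem_ideal_span_X_image]
  constructor
  · intro h
    rw [constantCoeff_eq]
    by_contra h0
    obtain ⟨i, -, hi⟩ := h 0 (mem_support_iff.2 h0)
    exact hi rfl
  · intro h m hm
    have : m ≠ 0 := by
      rintro rfl
      exact mem_support_iff.1 hm h
    obtain ⟨i, hi⟩ := Finsupp.ne_iff.1 this
    exact ⟨i, Set.mem_univ i, hi⟩

/-! ### Graded maps, and Koszul homology along a graded free cover -/

section Graded

variable {V : Type*} {K : Type*} [Field K]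
  {M : Type*} [AddCommGroup M] [Module (MvPolynomial V K) M]
  {M' : Type*} [AddCommGroup M'] [Module (MvPolynomial V K) M']

/-- A submodule is stable if it is graded, that is closed under taking homogeneous parts. -/
def DegreeProjection.Stable (π : DegreeProjection K V M) (N : Submodule (MvPolynomial V K) M) :
    Prop :=
  ∀ d, ∀ m ∈ N, π.proj d m ∈ N

/-- A linear map is graded if it commutes with the projections onto the homogeneous parts. -/
def DegreeProjection.IsGradedMap (π : DegreeProjection K V M) (π' : DegreeProjection K V M')
    (φ : M →ₗ[MvPolynomial V K] M') : Prop :=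
  ∀ d m, π'.proj d (φ m) = φ (π.proj d m)

theorem DegreeProjection.IsGradedMap.stable_ker {π : DegreeProjection K V M}
    {π' : DegreeProjection K V M'} {φ : M →ₗ[MvPolynomial V K] M'} (h : π.IsGradedMap π' φ) :
    π.Stable φ.ker := by
  intro d m hm
  rw [LinearMap.mem_ker] at hm ⊢
  rw [← h, hm, map_zero]

theorem isGradedMap_free {ι : Type*} [Finite ι] [DecidableEq ι] {deg : ι → ℤ}
    {π : DegreeProjection K V M} {φ : (ι → MvPolynomial V K) →ₗ[MvPolynomial V K] M}
    (h : ∀ a, π.proj (deg a) (φ (Pi.single a 1)) = φ (Pi.single a 1)) :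
    (DegreeProjection.free K V deg).IsGradedMap π φ := by
  have := Fintype.ofFinite ι
  have key : ∀ f : ι → MvPolynomial V K, φ f = ∑ a, f a • φ (Pi.single a 1) := by
    intro f
    conv_lhs => rw [pi_eq_sum_univ' f]
    simp only [map_sum, map_smul]
  intro d f
  rw [key f, key, map_sum]
  exact Finset.sum_congr rfl fun a _ => π.proj_smul _ _ _ _ (h a)

end Graded

section Vanishing

variable {V : Type*} [LinearOrder V] [Fintype V] {K : Type*} [Field K]
  {M : Type*} [AddCommGroup M] [Module (MvPolynomial V K) M]

/-- The Koszul homology of the submodule `N` in homological degrees less than `i` is zero in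
coefficient degrees greater than `r`. -/
def KoszulVanishingBelow (π : DegreeProjection K V M) (N : Submodule (MvPolynomial V K) M)
    (i : ℕ) (r : ℤ) : Prop :=
  ∀ d, r < d → ∀ c : Finset V → M, (∀ S, c S ∈ N) → (∀ S, π.proj d (c S) = c S) →
    (∀ S, i ≤ S.card → c S = 0) → koszulD K c = 0 →
    ∃ b : Finset V → M, (∀ S, b S ∈ N) ∧ koszulD K b = c

/-- The Koszul homology of the submodule `N` is zero in coefficient degrees greater than `r`. -/
def KoszulVanishing (π : DegreeProjection K V M) (N : Submodule (MvPolynomial V K) M)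
    (r : ℤ) : Prop :=
  ∀ d, r < d → ∀ c : Finset V → M, (∀ S, c S ∈ N) → (∀ S, π.proj d (c S) = c S) →
    koszulD K c = 0 → ∃ b : Finset V → M, (∀ S, b S ∈ N) ∧ koszulD K b = c

theorem exists_homogeneous_preimage {π : DegreeProjection K V M}
    {N : Submodule (MvPolynomial V K) M} (hN : π.Stable N) {d : ℤ} {b c : Finset V → M}
    (hb : ∀ S, b S ∈ N) (hc : ∀ S, π.proj d (c S) = c S) (h : koszulD K b = c) :
    ∃ b' : Finset V → M, (∀ S, b' S ∈ N) ∧ (∀ S, π.proj (d - 1) (b' S) = b' S) ∧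
      koszulD K b' = c := by
  refine ⟨fun S => π.proj (d - 1) (b S), fun S => hN _ _ (hb S), fun S => π.proj_proj _ _, ?_⟩
  rw [koszulD_proj, sub_add_cancel, h]
  ext1 S
  exact hc S

theorem proj_koszulD {π : DegreeProjection K V M} {d : ℤ} {c : Finset V → M}
    (hc : ∀ S, π.proj d (c S) = c S) (S : Finset V) :
    π.proj (d + 1) (koszulD K c S) = koszulD K c S := by
  rw [← congrFun (koszulD_proj K π d c) S]
  exact congrArg (fun c => koszulD K c S) (_root_.funext hc)

theorem koszulVanishing_poly :
    KoszulVanishing (DegreeProjection.poly K V) ⊤ 0 := by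
  intro d hd c _ hc h
  obtain ⟨b, hb⟩ := exists_koszulD_eq_of_degree_pos K hd hc h
  exact ⟨b, fun _ => trivial, hb⟩

theorem koszulVanishing_free {ι : Type*} [Finite ι] {deg : ι → ℤ} {r : ℤ}
    (hdeg : ∀ a, deg a ≤ r) : KoszulVanishing (DegreeProjection.free K V deg) ⊤ r := by
  intro d hd c _ hc h
  have key : ∀ a, ∃ b, koszulD K b = fun S => c S a := by
    intro a
    apply exists_koszulD_eq_of_degree_pos K (d := d - deg a) (by linarith [hdeg a])
    · intro S
      exact congrFun (hc S) a
    · have := koszulD_map K (LinearMap.proj (R := MvPolynomial V K) (φ := fun _ => _) a) c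
      rw [h] at this
      exact this
  choose b hb using key
  refine ⟨fun S a => b a S, fun _ => trivial, ?_⟩
  ext1 S
  ext1 a
  rw [← congrFun (hb a) S]
  exact (congrFun (koszulD_map K (LinearMap.proj (R := MvPolynomial V K) (φ := fun _ => _) a)
    (fun S a => b a S)) S).symm

variable {ι : Type*} {deg : ι → ℤ} {r : ℤ} {π : DegreeProjection K V M}
  {φ : (ι → MvPolynomial V K) →ₗ[MvPolynomial V K] M}

/-- The connecting map of `0 → ker φ → F → range φ → 0`: a cycle in the kernel bounds some `b` in
`F`, and `φ ∘ b` is a cycle one coefficient degree lower. It bounds there, and lifting that bound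
corrects `b` into the kernel. -/
theorem koszulVanishing_ker [Finite ι] (hφ : (DegreeProjection.free K V deg).IsGradedMap π φ)
    (hdeg : ∀ a, deg a ≤ r) (h : KoszulVanishing π φ.range r) :
    KoszulVanishing (DegreeProjection.free K V deg) φ.ker (r + 1) := by
  intro d hd c hcN hc hc0
  obtain ⟨b, -, hb⟩ := koszulVanishing_free hdeg d (by linarith) c (fun _ => trivial) hc hc0
  obtain ⟨b, -, hbd, hb⟩ := exists_homogeneous_preimage (fun _ _ _ => trivial : DegreeProjection.Stable
    (DegreeProjection.free K V deg) ⊤) (fun _ => trivial) hc hb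
  obtain ⟨e, heN, he⟩ := h (d - 1) (by linarith) (fun S => φ (b S)) (fun S => ⟨_, rfl⟩)
    (fun S => by rw [hφ, hbd]) (by
      rw [koszulD_map, hb]
      ext1 S
      exact hcN S)
  choose f hf using heN
  refine ⟨b - koszulD K f, fun S => ?_, by rw [map_sub, koszulD_koszulD, sub_zero, hb]⟩
  rw [LinearMap.mem_ker, Pi.sub_apply, map_sub, sub_eq_zero]
  have h1 := congrFun (koszulD_map K φ f) S
  simp only [hf] at h1
  rw [← h1, show (fun S => e S) = e from rfl, he]

/-- The same sequence read the other way: lift a cycle to `F`; its boundary lies in the kernel, one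
homological degree lower and one coefficient degree higher. -/
theorem koszulVanishingBelow_range [Finite ι] (hφ : (DegreeProjection.free K V deg).IsGradedMap π φ)
    (hdeg : ∀ a, deg a ≤ r) {i : ℕ}
    (h : KoszulVanishingBelow (DegreeProjection.free K V deg) φ.ker i (r + 1)) :
    KoszulVanishingBelow π φ.range (i + 1) r := by
  intro d hd c hcN hc hci hc0
  have : ∀ S, ∃ f, φ f = c S ∧ (DegreeProjection.free K V deg).proj d f = f ∧
      (i + 1 ≤ S.card → f = 0) := by
    intro S
    by_cases hS : i + 1 ≤ S.card
    · exact ⟨0, by rw [map_zero, hci S hS], map_zero _, fun _ => rfl⟩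
    · obtain ⟨f, hf⟩ := hcN S
      refine ⟨(DegreeProjection.free K V deg).proj d f, ?_, DegreeProjection.proj_proj _ _ _,
        fun h => absurd h hS⟩
      rw [← hφ, hf, hc]
  choose f hf hfd hfi using this
  obtain ⟨b, hbN, hb⟩ := h (d + 1) (by linarith) (koszulD K f)
    (fun S => by
      have h1 := congrFun (koszulD_map K φ f) S
      simp only [hf] at h1
      rw [LinearMap.mem_ker, ← h1, show (fun S => c S) = c from rfl, hc0]
      rfl)
    (proj_koszulD hfd)
    (fun S hS => by
      rw [koszulD_apply]
      refine Finset.sum_eq_zero fun v hv => ?_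
      rw [hfi, smul_zero, smul_zero]
      rw [Finset.card_insert_of_notMem (Finset.mem_compl.1 hv)]
      omega)
    (koszulD_koszulD K f)
  obtain ⟨b, hbN, hbd, hb⟩ := exists_homogeneous_preimage hφ.stable_ker hbN
    (proj_koszulD hfd) hb
  rw [add_sub_cancel_right] at hbd
  obtain ⟨e, -, he⟩ := koszulVanishing_free hdeg d hd (f - b) (fun _ => trivial)
    (fun S => by rw [Pi.sub_apply, map_sub, hfd, hbd]) (by rw [map_sub, hb, sub_self])
  refine ⟨fun S => φ (e S), fun S => ⟨_, rfl⟩, ?_⟩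
  rw [koszulD_map, he]
  ext1 S
  rw [Pi.sub_apply, map_sub, hf, LinearMap.mem_ker.1 (hbN S), sub_zero]

/-- In homological degree zero every chain is a cycle, and a boundary takes its value in `𝔪 · range
φ`. If a generator lay there, `φ` would kill an element whose entry at `a` has constant term 1,
against minimality. -/
theorem deg_le_of_koszulVanishing [DecidableEq ι]
    (hdeg : ∀ a, π.proj (deg a) (φ (Pi.single a 1)) = φ (Pi.single a 1))
    (hmin : ∀ f, φ f = 0 → ∀ a, constantCoeff (f a) = 0)
    (h : KoszulVanishing π φ.range r) (a : ι) : deg a ≤ r := by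
  by_contra! hr
  obtain ⟨b, hbN, hb⟩ := h (deg a) hr (fun S => if S = ∅ then φ (Pi.single a 1) else 0)
    (fun S => by
      split_ifs
      · exact ⟨_, rfl⟩
      · exact zero_mem _)
    (fun S => by
      split_ifs
      · exact hdeg a
      · exact map_zero _)
    (by
      ext1 S
      simp [koszulD_apply])
  choose f hf using hbN
  have h1 := congrFun (koszulD_map K φ f) ∅
  simp only [hf] at h1
  rw [show (fun S => b S) = b from rfl, hb] at h1
  simp only [if_true] at h1
  rw [← sub_eq_zero, ← map_sub] at h1
  have h2 := hmin _ h1 a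
  rw [koszulD_apply] at h2
  simp [Finset.sum_apply] at h2

end Vanishing

theorem mem_idealPart_iff {V : Type*} {K : Type*} [Field K] {I : Ideal (MvPolynomial V K)} (l : ℤ) (m : I) :
    m ∈ idealPart I l ↔ polyProj K V l m = m := by
  rw [← mem_polyPart_iff]
  rfl

/-! ### Existence of minimal graded free resolutions -/

section MinimalCover

variable {V : Type*} {K : Type*} [Field K] {M : Type*} [AddCommGroup M]
  [Module (MvPolynomial V K) M]

theorem exists_homogeneous_generators (π : DegreeProjection K V M)
    {N : Submodule (MvPolynomial V K) M} (hN : π.Stable N) (hfg : N.FG) :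
    ∃ n : ℕ, ∃ (deg : Fin n → ℤ) (g : Fin n → M), (∀ a, π.proj (deg a) (g a) = g a) ∧
      Submodule.span (MvPolynomial V K) (Set.range g) = N := by
  classical
  obtain ⟨s, hs⟩ := hfg
  choose D hD using π.exists_sum
  let t : Finset M := s.biUnion fun m => (D m).image fun d => π.proj d m
  have ht : ∀ x : t, ∃ d, π.proj d x = x := by
    rintro ⟨x, hx⟩
    simp only [t, Finset.mem_biUnion, Finset.mem_image] at hx
    obtain ⟨m, -, d, -, rfl⟩ := hx
    exact ⟨d, π.proj_proj d m⟩
  choose deg hdeg using ht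
  refine ⟨t.card, fun a => deg (t.equivFin.symm a), fun a => (t.equivFin.symm a : M),
    fun a => hdeg _, ?_⟩
  have hr : Set.range (fun a => (t.equivFin.symm a : M)) = t := by
    rw [show (fun a => (t.equivFin.symm a : M)) = Subtype.val ∘ t.equivFin.symm from rfl,
      Set.range_comp, Equiv.range_eq_univ, Set.image_univ, Subtype.range_coe]
  rw [hr]
  apply le_antisymm
  · rw [Submodule.span_le]
    intro x hx
    simp only [t, SetLike.mem_coe, Finset.mem_biUnion, Finset.mem_image] at hx
    obtain ⟨m, hm, d, -, rfl⟩ := hx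
    exact hN d m (hs ▸ Submodule.subset_span hm)
  · rw [← hs, Submodule.span_le]
    intro m hm
    rw [SetLike.mem_coe, hD m]
    refine Submodule.sum_mem _ fun d hd => Submodule.subset_span ?_
    exact Finset.mem_biUnion.2 ⟨m, hm, Finset.mem_image_of_mem _ hd⟩

theorem exists_minimal_cover (π : DegreeProjection K V M)
    {N : Submodule (MvPolynomial V K) M} (hN : π.Stable N) (hfg : N.FG) :
    ∃ (n : ℕ) (deg : Fin n → ℤ) (φ : (Fin n → MvPolynomial V K) →ₗ[MvPolynomial V K] M),
      φ.range = N ∧ (∀ a, π.proj (deg a) (φ (Pi.single a 1)) = φ (Pi.single a 1)) ∧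
      ∀ f, φ f = 0 → ∀ a, constantCoeff (f a) = 0 := by
  classical
  have hmin : ∀ Q : ℕ → Prop, (∃ n, Q n) → ∃ n, Q n ∧ ∀ k < n, ¬ Q k :=
    fun Q h => ⟨Nat.find h, Nat.find_spec h, fun _ => Nat.find_min h⟩
  -- Minimality comes from taking as few homogeneous generators as possible.
  obtain ⟨n, ⟨deg, g, hg, hspan⟩, hlt⟩ := hmin _ (exists_homogeneous_generators π hN hfg)
  have hsingle : ∀ a, Fintype.linearCombination (MvPolynomial V K) g (Pi.single a 1) = g a :=
    fun a => by rw [Fintype.linearCombination_apply_single, one_smul]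
  have hhom : ∀ a, π.proj (deg a) (Fintype.linearCombination (MvPolynomial V K) g
      (Pi.single a 1)) = Fintype.linearCombination (MvPolynomial V K) g (Pi.single a 1) := by
    intro a
    rw [hsingle, hg]
  refine ⟨n, deg, Fintype.linearCombination (MvPolynomial V K) g, ?_, hhom, ?_⟩
  · rw [Fintype.range_linearCombination, hspan]
  · intro f hf a
    by_contra hc
    have hgr := isGradedMap_free hhom (deg a) f
    rw [hf, map_zero, Fintype.linearCombination_apply] at hgr
    obtain _ | k := n
    · exact a.elim0
    rw [Fin.sum_univ_succAbove _ a] at hgr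
    -- In the degree `deg a` part of the relation, the coefficient of `g a` is a scalar. Were it
    -- nonzero, `g a` could be discarded.
    have hfa : (DegreeProjection.free K V deg).proj (deg a) f a = C (constantCoeff (f a)) := by
      rw [DegreeProjection.free_proj, sub_self, polyProj, if_pos le_rfl, Int.toNat_zero,
        homogeneousComponent_zero, constantCoeff_eq]
    rw [hfa] at hgr
    apply hlt k (Nat.lt_succ_self k)
    refine ⟨fun b => deg (a.succAbove b), fun b => g (a.succAbove b), fun b => hg _, ?_⟩
    rw [← hspan]
    apply le_antisymm
    · apply Submodule.span_mono
      rintro _ ⟨b, rfl⟩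
      exact ⟨_, rfl⟩
    · rw [Submodule.span_le]
      rintro _ ⟨b, rfl⟩
      rcases Fin.eq_self_or_eq_succAbove a b with rfl | ⟨b', rfl⟩
      · have h1 : g b = -((C (constantCoeff (f b))⁻¹ : MvPolynomial V K) •
            ∑ i, (DegreeProjection.free K V deg).proj (deg b) f (b.succAbove i) •
              g (b.succAbove i)) := by
          rw [eq_neg_iff_add_eq_zero]
          have h2 := congrArg ((C (constantCoeff (f b))⁻¹ : MvPolynomial V K) • ·) hgr
          simp only [smul_zero, smul_add, smul_smul, ← C_mul, inv_mul_cancel₀ hc, C_1,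
            one_smul] at h2
          exact h2.symm
        rw [SetLike.mem_coe, h1]
        refine Submodule.neg_mem _ (Submodule.smul_mem _ _ (Submodule.sum_mem _ fun i _ =>
          Submodule.smul_mem _ _ (Submodule.subset_span ⟨i, rfl⟩)))
      · exact Submodule.subset_span ⟨b', rfl⟩

end MinimalCover

/-- A graded submodule of a graded free module of finite rank. -/
structure GradedFreeSubmodule (K : Type*) [Field K] (V : Type*) where
  /-- the rank of the ambient free module -/
  rank : ℕ
  /-- the degrees of the basis elements of the ambient free module -/
  deg : Fin rank → ℤ
  /-- the submodule -/
  sub : Submodule (MvPolynomial V K) (Fin rank → MvPolynomial V K)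
  stable : (DegreeProjection.free K V deg).Stable sub

section Resolution

variable {V : Type*} [Finite V] {K : Type*} [Field K]

theorem GradedFreeSubmodule.exists_cover (S : GradedFreeSubmodule K V) :
    ∃ (T : GradedFreeSubmodule K V)
      (φ : (Fin T.rank → MvPolynomial V K) →ₗ[MvPolynomial V K] (Fin S.rank → MvPolynomial V K)),
      φ.range = S.sub ∧ T.sub = φ.ker ∧
      (∀ a, (DegreeProjection.free K V S.deg).proj (T.deg a) (φ (Pi.single a 1)) =
        φ (Pi.single a 1)) ∧
      ∀ f ∈ T.sub, ∀ a, constantCoeff (f a) = 0 := by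
  obtain ⟨n, deg, φ, h1, h2, h3⟩ := exists_minimal_cover _ S.stable (IsNoetherian.noetherian _)
  exact ⟨⟨n, deg, φ.ker, (isGradedMap_free h2).stable_ker⟩, φ, h1, rfl, h2, h3⟩

/-- A graded free module that covers the submodule minimally, with the kernel of the covering. -/
noncomputable def GradedFreeSubmodule.next (S : GradedFreeSubmodule K V) :
    GradedFreeSubmodule K V :=
  S.exists_cover.choose

/-- The covering of the submodule by the free module that contains `S.next`. -/
noncomputable def GradedFreeSubmodule.cover (S : GradedFreeSubmodule K V) :
    (Fin S.next.rank → MvPolynomial V K) →ₗ[MvPolynomial V K] (Fin S.rank → MvPolynomial V K) :=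
  S.exists_cover.choose_spec.choose

theorem GradedFreeSubmodule.cover_spec (S : GradedFreeSubmodule K V) :
    S.cover.range = S.sub ∧ S.next.sub = S.cover.ker ∧
      (∀ a, (DegreeProjection.free K V S.deg).proj (S.next.deg a) (S.cover (Pi.single a 1)) =
        S.cover (Pi.single a 1)) ∧
      ∀ f ∈ S.next.sub, ∀ a, constantCoeff (f a) = 0 :=
  S.exists_cover.choose_spec.choose_spec

theorem GradedFreeSubmodule.exact_cover (S : GradedFreeSubmodule K V) :
    Function.Exact S.next.cover S.cover :=
  LinearMap.exact_iff.2 (S.cover_spec.2.1.symm.trans S.next.cover_spec.1.symm)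

/-- The iterated syzygies of a graded submodule. -/
noncomputable def GradedFreeSubmodule.syzygy (S : GradedFreeSubmodule K V) :
    ℕ → GradedFreeSubmodule K V
  | 0 => S
  | i + 1 => (S.syzygy i).next

theorem GradedFreeSubmodule.constantCoeff_syzygy {S : GradedFreeSubmodule K V}
    (h : ∀ f ∈ S.sub, ∀ a, constantCoeff (f a) = 0) (i : ℕ) :
    ∀ f ∈ (S.syzygy i).sub, ∀ a, constantCoeff (f a) = 0 := by
  cases i with
  | zero => exact h
  | succ i => exact (S.syzygy i).cover_spec.2.2.2

theorem exists_minimalGradedFreeResolution {I : Ideal (MvPolynomial V K)}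
    (hI : (DegreeProjection.poly K V).Stable I) :
    Nonempty (MinimalGradedFreeResolution (V := V) (idealPart I)) := by
  obtain ⟨n, deg, φ, h1, h2, h3⟩ := exists_minimal_cover _ hI (IsNoetherian.noetherian _)
  let S : GradedFreeSubmodule K V := ⟨n, deg, φ.ker, (isGradedMap_free h2).stable_ker⟩
  have hφ : ∀ f, φ f ∈ I := fun f => h1 ▸ ⟨f, rfl⟩
  have h4 : Function.Exact S.cover (φ.codRestrict I hφ) := LinearMap.exact_iff.2
    ((LinearMap.ker_codRestrict _ _ _).trans S.cover_spec.1.symm)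
  exact ⟨{
    rank := fun i => (S.syzygy i).rank
    deg := fun i => (S.syzygy i).deg
    d := fun i => (S.syzygy i).cover
    aug := φ.codRestrict I hφ
    aug_homogeneous := fun a => (mem_idealPart_iff _ _).2 (h2 a)
    d_homogeneous := fun i b a =>
      (mem_polyPart_iff _ _).2 (congrFun ((S.syzygy i).cover_spec.2.2.1 b) a)
    aug_surjective := by
      rintro ⟨m, hm⟩
      obtain ⟨f, hf⟩ := h1.symm ▸ hm
      exact ⟨f, Subtype.ext hf⟩
    exact_zero := h4
    exact_succ := fun i => (S.syzygy i).exact_cover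
    minimal := fun i b a => by
      rw [mem_span_range_X_iff]
      refine S.constantCoeff_syzygy h3 i _ ?_ a
      rw [← (S.syzygy i).cover_spec.1]
      exact ⟨_, rfl⟩ }⟩

end Resolution

/-! ### Degrees in a minimal resolution and Koszul vanishing -/

namespace MinimalGradedFreeResolution

variable {V : Type*} {K : Type*} [Field K]
  {I : Ideal (MvPolynomial V K)} (F : MinimalGradedFreeResolution (V := V) (idealPart I))

theorem isGradedMap_d (i : ℕ) : (DegreeProjection.free K V (F.deg (i + 1))).IsGradedMap
    (DegreeProjection.free K V (F.deg i)) (F.d i) :=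
  isGradedMap_free fun b => by
    ext1 a
    exact (mem_polyPart_iff _ _).1 (F.d_homogeneous i b a)

/-- The augmentation, with values in the polynomial ring. -/
noncomputable def augPoly :
    (Fin (F.rank 0) → MvPolynomial V K) →ₗ[MvPolynomial V K] MvPolynomial V K :=
  I.subtype.comp F.aug

theorem proj_augPoly_single (a : Fin (F.rank 0)) : (DegreeProjection.poly K V).proj (F.deg 0 a)
    (F.augPoly (Pi.single a 1)) = F.augPoly (Pi.single a 1) :=
  (mem_idealPart_iff _ _).1 (F.aug_homogeneous a)

theorem isGradedMap_augPoly : (DegreeProjection.free K V (F.deg 0)).IsGradedMap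
    (DegreeProjection.poly K V) F.augPoly :=
  isGradedMap_free F.proj_augPoly_single

theorem range_augPoly : F.augPoly.range = I := by
  ext m
  constructor
  · rintro ⟨f, rfl⟩
    exact (F.aug f).2
  · intro hm
    obtain ⟨f, hf⟩ := F.aug_surjective ⟨m, hm⟩
    exact ⟨f, congrArg Subtype.val hf⟩

theorem ker_augPoly : F.augPoly.ker = (F.d 0).range := by
  rw [← LinearMap.exact_iff.1 F.exact_zero]
  ext f
  simp [augPoly]

theorem ker_d (i : ℕ) : (F.d i).ker = (F.d (i + 1)).range :=
  LinearMap.exact_iff.1 (F.exact_succ i)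

theorem constantCoeff_d (i : ℕ) (f : Fin (F.rank (i + 1)) → MvPolynomial V K)
    (a : Fin (F.rank i)) : constantCoeff (F.d i f a) = 0 := by
  rw [pi_eq_sum_univ' f]
  simp only [map_sum, map_smul, Finset.sum_apply, Pi.smul_apply, smul_eq_mul, map_mul]
  refine Finset.sum_eq_zero fun b _ => ?_
  have := mem_span_range_X_iff.1 (F.minimal i b a)
  rw [this, mul_zero]

theorem constantCoeff_of_augPoly_eq_zero (f : Fin (F.rank 0) → MvPolynomial V K)
    (hf : F.augPoly f = 0) (a : Fin (F.rank 0)) : constantCoeff (f a) = 0 := by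
  have : f ∈ F.augPoly.ker := hf
  rw [ker_augPoly] at this
  obtain ⟨g, rfl⟩ := this
  exact F.constantCoeff_d 0 g a

theorem constantCoeff_of_d_eq_zero (i : ℕ) (f : Fin (F.rank (i + 1)) → MvPolynomial V K)
    (hf : F.d i f = 0) (a : Fin (F.rank (i + 1))) : constantCoeff (f a) = 0 := by
  have : f ∈ (F.d i).ker := hf
  rw [ker_d] at this
  obtain ⟨g, rfl⟩ := this
  exact F.constantCoeff_d (i + 1) g a

theorem deg_le [LinearOrder V] [Fintype V] {r : ℤ} (h : KoszulVanishing (DegreeProjection.poly K V) I r) (i : ℕ)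
    (a : Fin (F.rank i)) : F.deg i a ≤ r + i := by
  rw [← F.range_augPoly] at h
  have h0 : ∀ a, F.deg 0 a ≤ r :=
    deg_le_of_koszulVanishing F.proj_augPoly_single F.constantCoeff_of_augPoly_eq_zero h
  have key : ∀ i : ℕ, KoszulVanishing (DegreeProjection.free K V (F.deg i)) (F.d i).range
      (r + i + 1) ∧ ∀ a, F.deg i a ≤ r + i := by
    intro i
    induction i with
    | zero =>
      have := koszulVanishing_ker F.isGradedMap_augPoly h0 h
      rw [ker_augPoly] at this
      simpa using ⟨this, h0⟩
    | succ i ih =>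
      have h1 : ∀ a, F.deg (i + 1) a ≤ r + i + 1 :=
        deg_le_of_koszulVanishing (fun b => by
          ext1 a
          exact (mem_polyPart_iff _ _).1 (F.d_homogeneous i b a))
          (F.constantCoeff_of_d_eq_zero i) ih.1
      have := koszulVanishing_ker (F.isGradedMap_d i) h1 ih.1
      rw [ker_d] at this
      push_cast
      rw [← add_assoc]
      exact ⟨this, h1⟩
  exact (key i).2 a

theorem koszulVanishing_of_deg_le [LinearOrder V] [Fintype V] {r : ℤ} (h : ∀ (i : ℕ) a, F.deg i a ≤ r + i) :
    KoszulVanishing (DegreeProjection.poly K V) I r := by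
  -- The resolution is not known to be finite, so the induction is on the homological degree `k` of
  -- Koszul chains, for all syzygies at once.
  have key : ∀ k i : ℕ, KoszulVanishingBelow (DegreeProjection.free K V (F.deg i))
      (F.d i).range k (r + i + 1) := by
    intro k
    induction k with
    | zero =>
      intro i d _ c _ _ hc _
      refine ⟨0, fun _ => zero_mem _, ?_⟩
      rw [map_zero]
      ext1 S
      exact (hc S (Nat.zero_le _)).symm
    | succ k ih =>
      intro i
      have := ih (i + 1)
      rw [← ker_d] at this
      push_cast at this
      rw [← add_assoc] at this
      refine koszulVanishingBelow_range (F.isGradedMap_d i) (fun a => ?_) this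
      simpa [add_assoc] using h (i + 1) a
  intro d hd c hcN hc hc0
  have h1 := key (Fintype.card V) 0
  rw [← ker_augPoly] at h1
  rw [← F.range_augPoly] at hcN ⊢
  -- No subset of `V` has more than `|V|` elements, so the bound on the homological degree is now
  -- vacuous.
  refine koszulVanishingBelow_range F.isGradedMap_augPoly (fun a => ?_)
    (by simpa using h1) d hd c hcN hc (fun S hS => ?_) hc0
  · simpa using h 0 a
  · have := Finset.card_le_univ S
    omega

end MinimalGradedFreeResolution

/-! ### Monomial ideals and edge ideals of induced subgraphs -/

section MonomialIdeal

variable {V : Type*} {K : Type*} [Field K]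

/-- The ideal `I` consists of the polynomials all of whose monomials satisfy `Q`. -/
def IsMonomialIdeal (I : Ideal (MvPolynomial V K)) (Q : (V →₀ ℕ) → Prop) : Prop :=
  ∀ p, p ∈ I ↔ ∀ m ∈ p.support, Q m

theorem IsMonomialIdeal.stable {I : Ideal (MvPolynomial V K)} {Q : (V →₀ ℕ) → Prop}
    (h : IsMonomialIdeal I Q) : (DegreeProjection.poly K V).Stable I := by
  intro d p hp
  rw [DegreeProjection.poly_proj]
  refine (h _).2 fun m hm => (h _).1 hp m ?_
  rw [mem_support_iff, coeff_polyProj] at hm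
  rw [mem_support_iff]
  intro h0
  simp [h0] at hm

theorem isMonomialIdeal_top : IsMonomialIdeal (⊤ : Ideal (MvPolynomial V K)) fun _ => True :=
  fun p => by simp

theorem isMonomialIdeal_span_X (S : Set V) :
    IsMonomialIdeal (Ideal.span ((X : V → MvPolynomial V K) '' S)) fun m => ∃ i ∈ S, m i ≠ 0 :=
  fun _ => mem_ideal_span_X_image

/-- The edge ideal of the subgraph induced on `W`, in the polynomial ring of the whole graph. -/
noncomputable def SimpleGraph.edgeIdealOn (K : Type*) [Field K] (G : SimpleGraph V) (W : Set V) :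
    Ideal (MvPolynomial V K) :=
  Ideal.span {p | ∃ u ∈ W, ∃ v ∈ W, G.Adj u v ∧ p = X u * X v}

theorem SimpleGraph.edgeIdealOn_univ (G : SimpleGraph V) :
    G.edgeIdealOn K Set.univ = G.edgeIdeal K := by
  simp [edgeIdealOn, edgeIdeal]

theorem SimpleGraph.isMonomialIdeal_edgeIdealOn (G : SimpleGraph V) (W : Set V) :
    IsMonomialIdeal (G.edgeIdealOn K W)
      fun m => ∃ u ∈ W, ∃ v ∈ W, G.Adj u v ∧ m u ≠ 0 ∧ m v ≠ 0 := by
  classical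
  have : {p : MvPolynomial V K | ∃ u ∈ W, ∃ v ∈ W, G.Adj u v ∧ p = X u * X v} =
      (fun s => monomial s (1 : K)) '' {s | ∃ u ∈ W, ∃ v ∈ W, G.Adj u v ∧
        s = Finsupp.single u 1 + Finsupp.single v 1} := by
    ext p
    constructor
    · rintro ⟨u, hu, v, hv, huv, rfl⟩
      exact ⟨_, ⟨u, hu, v, hv, huv, rfl⟩, by simp [X, monomial_mul]⟩
    · rintro ⟨_, ⟨u, hu, v, hv, huv, rfl⟩, rfl⟩
      exact ⟨u, hu, v, hv, huv, by simp [X, monomial_mul]⟩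
  intro p
  rw [edgeIdealOn, this, mem_ideal_span_monomial_image]
  refine forall₂_congr fun m _ => ?_
  constructor
  · rintro ⟨_, ⟨u, hu, v, hv, huv, rfl⟩, hs⟩
    refine ⟨u, hu, v, hv, huv, ?_, ?_⟩
    · have := hs u
      simp at this
      omega
    · have := hs v
      simp at this
      omega
  · rintro ⟨u, hu, v, hv, huv, h1, h2⟩
    refine ⟨_, ⟨u, hu, v, hv, huv, rfl⟩, fun w => ?_⟩
    have := huv.ne
    simp only [Finsupp.add_apply, Finsupp.single_apply]
    split_ifs <;> grind

end MonomialIdeal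

/-! ### Splitting off a variable; vanishing from simplicial vertices -/

section Vanishing

variable {V : Type*} [LinearOrder V] [Fintype V] {K : Type*} [Field K]

/-- A chain-level form of the long exact sequence of `0 → J(-1) → P(-1) ⊕ J → I → 0`, the first map
being `a ↦ (a, -x_v a)`. Exactness in the middle is `hJ`: `x_v` is a nonzerodivisor modulo `J`. -/
theorem koszulVanishing_of_decomposition {I P J : Ideal (MvPolynomial V K)} {r : ℤ} (v : V)
    (hI : ∀ p ∈ I, ∃ a ∈ P, ∃ b ∈ J, p = X v * a + b) (hPI : ∀ p ∈ P, X v * p ∈ I) (hJI : J ≤ I)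
    (hJP : J ≤ P) (hJ : ∀ p, X v * p ∈ J → p ∈ J) (hPs : (DegreeProjection.poly K V).Stable P)
    (hJs : (DegreeProjection.poly K V).Stable J)
    (hPv : KoszulVanishing (DegreeProjection.poly K V) P (r - 1))
    (hJv : KoszulVanishing (DegreeProjection.poly K V) J r) :
    KoszulVanishing (DegreeProjection.poly K V) I r := by
  intro d hd c hcI hc hc0
  have : ∀ S, ∃ p ∈ P, ∃ q ∈ J, polyProj K V (d - 1) p = p ∧ polyProj K V d q = q ∧
      c S = X v * p + q := by
    intro S
    obtain ⟨p, hp, q, hq, h⟩ := hI _ (hcI S)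
    refine ⟨polyProj K V (d - 1) p, hPs _ _ hp, polyProj K V d q, hJs _ _ hq,
      DegreeProjection.proj_proj (DegreeProjection.poly K V) _ _,
      DegreeProjection.proj_proj (DegreeProjection.poly K V) _ _, ?_⟩
    rw [← hc S, h, DegreeProjection.poly_proj, map_add, ← polyProj_X_mul, sub_add_cancel]
  choose p hp q hq hpd hqd hpq using this
  have hcpq : c = (X v : MvPolynomial V K) • p + q := _root_.funext hpq
  have h1 : (X v : MvPolynomial V K) • koszulD K p = -koszulD K q := by
    rw [eq_neg_iff_add_eq_zero, ← map_smul, ← map_add, ← hcpq, hc0]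
  -- This is the connecting map: `∂p` is a cycle in `J`. Bounding it by `b` there turns `p - b` and
  -- `q + x_v b` into cycles.
  have h2 : ∀ S, koszulD K p S ∈ J := by
    intro S
    apply hJ
    have := congrFun h1 S
    rw [Pi.smul_apply, smul_eq_mul] at this
    rw [this]
    exact neg_mem (koszulD_mem K (N := J) hq S)
  have h3 := proj_koszulD (π := DegreeProjection.poly K V) hpd
  rw [sub_add_cancel] at h3
  obtain ⟨b, hbJ, hb⟩ := hJv d hd _ h2 h3 (koszulD_koszulD K p)
  obtain ⟨b, hbJ, hbd, hb⟩ := exists_homogeneous_preimage hJs hbJ h3 hb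
  obtain ⟨e, heP, he⟩ := hPv (d - 1) (by linarith) (p - b)
    (fun S => sub_mem (hp S) (hJP (hbJ S)))
    (fun S => by
      rw [Pi.sub_apply, map_sub, hbd]
      exact congrArg (· - b S) (hpd S))
    (by rw [map_sub, hb, sub_self])
  obtain ⟨f, hfJ, hf⟩ := hJv d hd (q + (X v : MvPolynomial V K) • b)
    (fun S => add_mem (hq S) (J.mul_mem_left _ (hbJ S)))
    (fun S => by
      have := hbd S
      simp only [DegreeProjection.poly_proj] at this
      rw [Pi.add_apply, Pi.smul_apply, map_add, smul_eq_mul, DegreeProjection.poly_proj,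
        DegreeProjection.poly_proj, hqd]
      nth_rw 2 [← this]
      rw [← polyProj_X_mul, sub_add_cancel])
    (by rw [map_add, map_smul, hb, h1, add_neg_cancel])
  refine ⟨(X v : MvPolynomial V K) • e + f,
    fun S => add_mem (hPI _ (heP S)) (hJI (hfJ S)), ?_⟩
  rw [map_add, map_smul, he, hf, hcpq, smul_sub]
  abel

theorem koszulVanishing_of_isMonomialIdeal {I P J : Ideal (MvPolynomial V K)}
    {QI QP QJ : (V →₀ ℕ) → Prop} (hI : IsMonomialIdeal I QI) (hP : IsMonomialIdeal P QP)
    (hJ : IsMonomialIdeal J QJ) {r : ℤ} (v : V)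
    (h1 : ∀ m, QI (Finsupp.single v 1 + m) → QP m) (h2 : ∀ m, m v = 0 → QI m → QJ m)
    (h3 : ∀ m, QP m → QI (Finsupp.single v 1 + m)) (h4 : ∀ m, QJ m → QI m)
    (h5 : ∀ m, QJ m → QP m) (h6 : ∀ m, QJ (Finsupp.single v 1 + m) → QJ m)
    (hPv : KoszulVanishing (DegreeProjection.poly K V) P (r - 1))
    (hJv : KoszulVanishing (DegreeProjection.poly K V) J r) :
    KoszulVanishing (DegreeProjection.poly K V) I r := by
  refine koszulVanishing_of_decomposition v ?_ ?_ ?_ ?_ ?_ hP.stable hJ.stable hPv hJv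
  · intro p hp
    refine ⟨p.divMonomial (Finsupp.single v 1), ?_, p.modMonomial (Finsupp.single v 1), ?_,
      (divMonomial_add_modMonomial_single p v).symm⟩
    · refine (hP _).2 fun m hm => h1 m ((hI _).1 hp _ ?_)
      rwa [mem_support_iff, coeff_divMonomial, ← mem_support_iff] at hm
    · refine (hJ _).2 fun m hm => ?_
      rw [mem_support_iff] at hm
      have hmv : m v = 0 := by
        by_contra h
        exact hm (varFree_modMonomial v p m h)
      refine h2 m hmv ((hI _).1 hp m ?_)
      rwa [coeff_modMonomial_of_not_le _ (by
        rw [Finsupp.single_le_iff]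
        omega), ← mem_support_iff] at hm
  · intro p hp
    refine (hI _).2 fun m hm => ?_
    rw [support_X_mul, Finset.mem_map] at hm
    obtain ⟨m, hm, rfl⟩ := hm
    exact h3 m ((hP _).1 hp m hm)
  · exact fun p hp => (hI _).2 fun m hm => h4 m ((hJ _).1 hp m hm)
  · exact fun p hp => (hP _).2 fun m hm => h5 m ((hJ _).1 hp m hm)
  · intro p hp
    refine (hJ _).2 fun m hm => h6 m ((hJ _).1 hp _ ?_)
    rw [mem_support_iff] at hm ⊢
    rwa [coeff_X_mul]

theorem koszulVanishing_of_isMonomialIdeal_false {J : Ideal (MvPolynomial V K)}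
    {Q : (V →₀ ℕ) → Prop} (hJ : IsMonomialIdeal J Q) (hQ : ∀ m, ¬ Q m) (r : ℤ) :
    KoszulVanishing (DegreeProjection.poly K V) J r := by
  intro d _ c hc _ _
  refine ⟨0, fun _ => zero_mem _, ?_⟩
  rw [map_zero]
  ext1 S
  by_contra h
  obtain ⟨m, hm⟩ := support_nonempty.2 (Ne.symm h)
  exact hQ m ((hJ _).1 (hc S) m hm)

theorem koszulVanishing_span_X (S : Finset V) : KoszulVanishing (DegreeProjection.poly K V)
    (Ideal.span ((X : V → MvPolynomial V K) '' S)) 1 := by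
  induction S using Finset.induction_on with
  | empty => exact koszulVanishing_of_isMonomialIdeal_false (isMonomialIdeal_span_X _) (by simp) 1
  | insert v S hv ih =>
    -- Here `P` is the whole ring, whose bound 0 is one less than the bound 1 for `J`.
    refine koszulVanishing_of_isMonomialIdeal (isMonomialIdeal_span_X _) isMonomialIdeal_top
      (isMonomialIdeal_span_X _) v (fun _ _ => trivial) ?_ ?_ ?_ (fun _ _ => trivial) ?_
      (by simpa using koszulVanishing_poly) ih
    · rintro m hm ⟨i, hi, hmi⟩
      refine ⟨i, ?_, hmi⟩
      rcases Finset.mem_insert.1 hi with rfl | hi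
      · exact absurd hm hmi
      · exact hi
    · exact fun m _ => ⟨v, by simp, by simp⟩
    · rintro m ⟨i, hi, hmi⟩
      exact ⟨i, Finset.mem_insert_of_mem hi, hmi⟩
    · rintro m ⟨i, hi, hmi⟩
      refine ⟨i, hi, ?_⟩
      have : v ≠ i := fun h => hv (h ▸ hi)
      simpa [Finsupp.single_apply, this] using hmi

theorem SimpleGraph.koszulVanishing_edgeIdealOn (G : SimpleGraph V)
    (hG : ∀ W : Finset V, W.Nonempty → ∃ v ∈ W, ∀ a ∈ W, ∀ b ∈ W,
      Gᶜ.Adj v a → Gᶜ.Adj v b → a ≠ b → Gᶜ.Adj a b) (W : Finset V) :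
    KoszulVanishing (DegreeProjection.poly K V) (G.edgeIdealOn K W) 2 := by
  classical
  induction W using Finset.strongInduction with
  | H W ih =>
    rcases W.eq_empty_or_nonempty with rfl | hW
    · exact koszulVanishing_of_isMonomialIdeal_false (G.isMonomialIdeal_edgeIdealOn _) (by simp) 2
    obtain ⟨v, hv, hs⟩ := hG W hW
    simp only [SimpleGraph.compl_adj] at hs
    refine koszulVanishing_of_isMonomialIdeal (G.isMonomialIdeal_edgeIdealOn _)
      (isMonomialIdeal_span_X ((W.filter (G.Adj v) : Finset V) : Set V))
      (G.isMonomialIdeal_edgeIdealOn _) v ?_ ?_ ?_ ?_ ?_ ?_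
      (koszulVanishing_span_X _) (ih (W.erase v) (Finset.erase_ssubset hv))
    · rintro m ⟨a, ha, b, hb, hab, h1, h2⟩
      simp only [Finsupp.add_apply, Finsupp.single_apply, Finset.mem_coe, Finset.mem_filter]
        at ha hb h1 h2 ⊢
      have := hab.ne
      have := hab.symm
      -- Otherwise `a` and `b` are both neighbours of `v` in the complement, hence adjacent there
      -- and not in `G`.
      have : v = a ∨ v = b ∨ G.Adj v a ∨ G.Adj v b := by
        by_contra! h
        exact (hs a ha b hb ⟨h.1, h.2.2.1⟩ ⟨h.2.1, h.2.2.2⟩ hab.ne).2 hab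
      clear hs ih hG
      grind
    · rintro m hm ⟨a, ha, b, hb, hab, h1, h2⟩
      simp only [Finset.mem_coe, Finset.mem_erase] at ha hb ⊢
      grind
    · rintro m ⟨i, hi, hmi⟩
      simp only [Finset.mem_coe, Finset.mem_filter] at hi
      exact ⟨v, hv, i, hi.1, hi.2, by simp, by simp [hmi]⟩
    · rintro m ⟨a, ha, b, hb, h⟩
      exact ⟨a, Finset.mem_of_mem_erase ha, b, Finset.mem_of_mem_erase hb, h⟩
    · rintro m ⟨a, ha, b, hb, hab, h1, h2⟩
      simp only [Finset.mem_coe, Finset.mem_erase, Finset.mem_filter] at ha hb ⊢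
      have := hab.ne
      have : G.Adj v a ∨ G.Adj v b := by
        by_contra! h
        exact (hs a ha.2 b hb.2 ⟨Ne.symm ha.1, h.1⟩ ⟨Ne.symm hb.1, h.2⟩ hab.ne).2 hab
      clear hs ih hG
      grind
    · rintro m ⟨a, ha, b, hb, hab, h1, h2⟩
      simp only [Finset.mem_coe, Finset.mem_erase] at ha hb
      refine ⟨a, by simp [ha], b, by simp [hb], hab, ?_, ?_⟩
      · simpa [Finsupp.single_apply, Ne.symm ha.1] using h1
      · simpa [Finsupp.single_apply, Ne.symm hb.1] using h2

end Vanishing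

/-! ### Dirac's theorem: chordal graphs have simplicial vertices -/

namespace SimpleGraph

variable {V : Type*}

theorem cycleGraph_adj_of_lt {n : ℕ} {i j : Fin n} (h : i < j) :
    (cycleGraph n).Adj i j ↔ (j : ℕ) = i + 1 ∨ ((i : ℕ) = 0 ∧ (j : ℕ) + 1 = n) := by
  rw [cycleGraph_adj', Fin.sub_val_of_le h.le, Fin.coe_sub_iff_lt.2 h]
  have := i.2
  have := j.2
  rw [Fin.lt_def] at h
  omega

theorem nonempty_embedding_of_forall_lt {n : ℕ} {H : SimpleGraph V} (q : ℕ → V)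
    (hne : ∀ i j, i < j → j < n → q i ≠ q j)
    (hadj : ∀ i j, i < j → j < n → (H.Adj (q i) (q j) ↔ j = i + 1 ∨ (i = 0 ∧ j + 1 = n))) :
    (cycleGraph n).IsIndContained H := by
  refine ⟨⟨⟨fun i => q i, ?_⟩, ?_⟩⟩
  · intro i j hij
    by_contra hne'
    rcases lt_or_gt_of_ne hne' with h | h
    · exact hne i j h j.2 hij
    · exact hne j i h i.2 hij.symm
  · intro i j
    change H.Adj (q i) (q j) ↔ _
    rcases lt_trichotomy i j with h | rfl | h
    · rw [hadj i j h j.2, cycleGraph_adj_of_lt h]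
    · simp
    · rw [H.adj_comm, hadj j i h i.2, adj_comm, cycleGraph_adj_of_lt h]

theorem isIndContained_of_path {H : SimpleGraph V} {m : ℕ} {p : ℕ → V} {v : V}
    (hne : ∀ i j, i < j → j ≤ m → p i ≠ p j)
    (hadj : ∀ i j, i < j → j ≤ m → (H.Adj (p i) (p j) ↔ j = i + 1))
    (hv : ∀ k ≤ m, p k ≠ v) (hadjv : ∀ k ≤ m, (H.Adj (p k) v ↔ k = 0 ∨ k = m)) :
    (cycleGraph (m + 2)).IsIndContained H := by
  refine nonempty_embedding_of_forall_lt (fun k => if k ≤ m then p k else v) ?_ ?_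
  · intro i j hij hj
    have hi : i ≤ m := by omega
    simp only [hi, if_true]
    split_ifs with hjm
    · exact hne i j hij hjm
    · exact hv i hi
  · intro i j hij hj
    have hi : i ≤ m := by omega
    simp only [hi, if_true]
    split_ifs with hjm
    · rw [hadj i j hij hjm]
      omega
    · rw [hadjv i hi]
      omega

/-- A shortest walk works: its `i`-th vertex is at distance `i` from `a`, so it has neither
repetitions nor chords. -/
theorem Reachable.exists_induced_path {H : SimpleGraph V} {a b : V} (h : H.Reachable a b) :
    ∃ (m : ℕ) (p : ℕ → V), p 0 = a ∧ p m = b ∧ (∀ i j, i < j → j ≤ m → p i ≠ p j) ∧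
      ∀ i j, i < j → j ≤ m → (H.Adj (p i) (p j) ↔ j = i + 1) := by
  obtain ⟨w, hw⟩ := h.exists_walk_length_eq_dist
  have hd : ∀ i ≤ w.length, H.dist a (w.getVert i) = i := by
    intro i hi
    have h1 := dist_le (w.take i)
    have h2 := dist_le (w.drop i)
    have h3 := (w.take i).reachable.dist_triangle_left b
    rw [Walk.take_length] at h1
    rw [Walk.drop_length] at h2
    omega
  refine ⟨w.length, w.getVert, w.getVert_zero, w.getVert_length, ?_, ?_⟩
  · intro i j hij hj heq
    have h1 := hd i (by omega)
    have h2 := hd j hj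
    rw [heq] at h1
    omega
  · intro i j hij hj
    constructor
    · intro hadj
      have h1 := hd i (by omega)
      have h2 := hd j hj
      have h3 := (w.take i).reachable.dist_triangle_left (w.getVert j)
      have h4 := dist_eq_one_iff_adj.2 hadj
      omega
    · rintro rfl
      exact w.adj_getVert_succ (by omega)

/-- The spanning subgraph whose edges are the edges of `H` with both ends in `A`. -/
def restrictTo (H : SimpleGraph V) (A : Set V) : SimpleGraph V where
  Adj x y := H.Adj x y ∧ x ∈ A ∧ y ∈ A
  symm := ⟨fun _ _ h => ⟨h.1.symm, h.2.2, h.2.1⟩⟩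
  loopless := ⟨fun _ h => h.1.ne rfl⟩

theorem restrictTo_adj {H : SimpleGraph V} {A : Set V} {x y : V} :
    (H.restrictTo A).Adj x y ↔ H.Adj x y ∧ x ∈ A ∧ y ∈ A := Iff.rfl

/-- The neighbours of `x` in `W` form a clique. -/
def IsSimplicialIn (H : SimpleGraph V) (W : Finset V) (x : V) : Prop :=
  ∀ a ∈ W, ∀ b ∈ W, H.Adj x a → H.Adj x b → a ≠ b → H.Adj a b

/-- If `a` and `b` were not adjacent, a shortest path between them through `C` would have length `m
≥ 2`. As `v` sees only its two ends, `v` would close it to an induced cycle of length `m + 2 ≥ 4`.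
-/
theorem IsChordalGraph.adj_of_common_component {H : SimpleGraph V} (hH : H.IsChordalGraph)
    {C : Set V} {v a b c c' : V} (hC : ∀ x ∈ C, x ≠ v ∧ ¬ H.Adj v x)
    (hconn : ∀ x ∈ C, ∀ y ∈ C, (H.restrictTo C).Reachable x y) (hva : H.Adj v a)
    (hvb : H.Adj v b) (hc : c ∈ C) (hc' : c' ∈ C) (hac : H.Adj a c) (hbc : H.Adj b c')
    (hab : a ≠ b) : H.Adj a b := by
  by_contra hnadj
  let B : Set V := insert a (insert b C)
  have hCB : C ⊆ B := fun x hx => Or.inr (Or.inr hx)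
  have haB : a ∈ B := Or.inl rfl
  have hbB : b ∈ B := Or.inr (Or.inl rfl)
  have hle : H.restrictTo C ≤ H.restrictTo B := fun x y h => ⟨h.1, hCB h.2.1, hCB h.2.2⟩
  have hreach : (H.restrictTo B).Reachable a b := by
    have h1 : (H.restrictTo B).Adj a c := ⟨hac, haB, hCB hc⟩
    have h2 : (H.restrictTo B).Adj c' b := ⟨hbc.symm, hCB hc', hbB⟩
    exact h1.reachable.trans (((hconn c hc c' hc').mono hle).trans h2.reachable)
  obtain ⟨m, p, hp0, hpm, hne, hadj⟩ := hreach.exists_induced_path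
  have hm0 : m ≠ 0 := by
    rintro rfl
    exact hab (hp0.symm.trans hpm)
  have hm1 : m ≠ 1 := by
    rintro rfl
    have := (hadj 0 1 Nat.zero_lt_one le_rfl).2 rfl
    rw [hp0, hpm] at this
    exact hnadj this.1
  have hpB : ∀ k ≤ m, p k ∈ B := by
    intro k hk
    rcases Nat.eq_zero_or_pos k with rfl | hk0
    · rw [hp0]
      exact haB
    · have := (hadj (k - 1) k (by omega) hk).2 (by omega)
      exact this.2.2
  have hpC : ∀ k ≤ m, k ≠ 0 → k ≠ m → p k ∈ C := by
    intro k hk h0 h1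
    rcases hpB k hk with h | h | h
    · exact absurd (hp0.trans h.symm) (hne 0 k (by omega) hk)
    · exact absurd (h.trans hpm.symm) (hne k m (by omega) le_rfl)
    · exact h
  refine hH (m + 2) (by omega) (isIndContained_of_path (p := p) (v := v) hne ?_ ?_ ?_)
  · intro i j hij hj
    rw [← hadj i j hij hj, restrictTo_adj]
    exact ⟨fun h => ⟨h, hpB i (by omega), hpB j hj⟩, fun h => h.1⟩
  · intro k hk
    by_cases h0 : k = 0
    · rw [h0, hp0]
      exact hva.ne'
    by_cases h1 : k = m
    · rw [h1, hpm]
      exact hvb.ne'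
    exact (hC _ (hpC k hk h0 h1)).1
  · intro k hk
    constructor
    · intro h
      by_contra! hcon
      exact (hC _ (hpC k hk hcon.1 hcon.2)).2 h.symm
    · rintro (rfl | rfl)
      · rw [hp0]
        exact hva.symm
      · rw [hpm]
        exact hvb.symm

/-- Demanding a simplicial vertex away from a prescribed `v` is what lets the induction run: it
steers the vertex found in a smaller set away from the separating clique. -/
theorem IsChordalGraph.exists_isSimplicialIn_not_adj {H : SimpleGraph V} (hH : H.IsChordalGraph)
    (W : Finset V) : ∀ v ∈ W, (∃ u ∈ W, u ≠ v ∧ ¬ H.Adj v u) →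
      ∃ x ∈ W, x ≠ v ∧ ¬ H.Adj v x ∧ H.IsSimplicialIn W x := by
  classical
  induction W using Finset.strongInduction with
  | H W ih =>
    rintro v hv ⟨u, huW, huv, hadj⟩
    let A : Set V := {x | x ∈ W ∧ x ≠ v ∧ ¬ H.Adj v x}
    -- `C` is the component of `u` among the non-neighbours of `v`. Its boundary `S` consists of
    -- neighbours of `v` and is a clique; `C ∪ S` misses `v`, and vertices of `C` have all their
    -- `W`-neighbours in it.
    let C : Set V := {x | (H.restrictTo A).Reachable u x}
    have huC : u ∈ C := Reachable.refl u
    have hCA : ∀ x ∈ C, x ∈ A ∧ (H.restrictTo C).Reachable u x := by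
      intro x hx
      have hx' : (H.restrictTo A).Reachable u x := hx
      rw [reachable_iff_reflTransGen] at hx'
      induction hx' with
      | refl => exact ⟨⟨huW, huv, hadj⟩, Reachable.refl u⟩
      | @tail y z hy hyz ih' =>
        rw [← reachable_iff_reflTransGen] at hy
        refine ⟨hyz.2.2, (ih' hy).2.trans (Adj.reachable ⟨hyz.1, hy, hy.trans hyz.reachable⟩)⟩
    have hCclosed : ∀ x ∈ C, ∀ y ∈ A, H.Adj x y → y ∈ C := by
      intro x hx y hy hxy
      have : (H.restrictTo A).Adj x y := ⟨hxy, (hCA x hx).1, hy⟩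
      exact Reachable.trans hx this.reachable
    let S : Set V := {s | s ∈ W ∧ s ∉ C ∧ ∃ c ∈ C, H.Adj s c}
    have hvS : ∀ s ∈ S, H.Adj v s := by
      rintro s ⟨hsW, hsC, c, hc, hsc⟩
      by_contra h
      refine hsC (hCclosed c hc s ⟨hsW, ?_, h⟩ hsc.symm)
      rintro rfl
      exact (hCA c hc).1.2.2 hsc
    have hSclique : ∀ a ∈ S, ∀ b ∈ S, a ≠ b → H.Adj a b := by
      intro a ha b hb hab
      obtain ⟨c, hc, hac⟩ := ha.2.2
      obtain ⟨c', hc', hbc⟩ := hb.2.2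
      exact hH.adj_of_common_component (fun x hx => (hCA x hx).1.2)
        (fun x hx y hy => (hCA x hx).2.symm.trans (hCA y hy).2) (hvS a ha) (hvS b hb) hc hc'
        hac hbc hab
    let W' : Finset V := W.filter fun x => x ∈ C ∨ x ∈ S
    have hmem : ∀ x, x ∈ W' ↔ x ∈ C ∨ x ∈ S := by
      intro x
      simp only [W', Finset.mem_filter, and_iff_right_iff_imp]
      rintro (h | h)
      · exact (hCA x h).1.1
      · exact h.1
    have hW' : W' ⊂ W := by
      refine Finset.filter_ssubset.2 ⟨v, hv, ?_⟩
      rintro (h | h)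
      · exact (hCA v h).1.2.1 rfl
      · exact (hvS v h).ne rfl
    have hlift : ∀ x ∈ C, H.IsSimplicialIn W' x → H.IsSimplicialIn W x := by
      intro x hx hsimp a ha b hb hxa hxb hab
      have key : ∀ y ∈ W, H.Adj x y → y ∈ W' := by
        intro y hy hxy
        rw [hmem]
        by_cases hyC : y ∈ C
        · exact Or.inl hyC
        · exact Or.inr ⟨hy, hyC, x, hx, hxy.symm⟩
      exact hsimp a (key a ha hxa) b (key b hb hxb) hxa hxb hab
    -- Induction applies at a vertex of `S`, or else of `C`, that is not adjacent to all of `W'`.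
    -- The vertex found cannot lie in `S`: in the first case `S` is a clique, in the second its
    -- vertices see all of `W'`. If no such vertex exists, `W'` is a clique.
    have hex : ∃ x ∈ C, H.IsSimplicialIn W' x := by
      by_cases h1 : ∃ y ∈ S, ∃ z ∈ W', z ≠ y ∧ ¬ H.Adj y z
      · obtain ⟨y, hy, hz⟩ := h1
        obtain ⟨x, hx, hxy, hnadj, hs⟩ := ih W' hW' y ((hmem y).2 (Or.inr hy)) hz
        rcases (hmem x).1 hx with h | h
        · exact ⟨x, h, hs⟩
        · exact absurd (hSclique y hy x h (Ne.symm hxy)) hnadj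
      · push Not at h1
        by_cases h2 : ∃ y ∈ C, ∃ z ∈ W', z ≠ y ∧ ¬ H.Adj y z
        · obtain ⟨y, hy, hz⟩ := h2
          obtain ⟨x, hx, hxy, hnadj, hs⟩ := ih W' hW' y ((hmem y).2 (Or.inl hy)) hz
          rcases (hmem x).1 hx with h | h
          · exact ⟨x, h, hs⟩
          · exact absurd (h1 x h y ((hmem y).2 (Or.inl hy)) (Ne.symm hxy)).symm hnadj
        · push Not at h2
          refine ⟨u, huC, fun a ha b hb _ _ hab => ?_⟩
          rcases (hmem a).1 ha with h | h
          · exact h2 a h b hb (Ne.symm hab)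
          · exact h1 a h b hb (Ne.symm hab)
    obtain ⟨x, hx, hs⟩ := hex
    exact ⟨x, (hCA x hx).1.1, (hCA x hx).1.2.1, (hCA x hx).1.2.2, hlift x hx hs⟩

theorem IsChordalGraph.exists_isSimplicialIn {H : SimpleGraph V} (hH : H.IsChordalGraph)
    {W : Finset V} (hW : W.Nonempty) : ∃ x ∈ W, H.IsSimplicialIn W x := by
  by_cases h : ∃ v ∈ W, ∃ u ∈ W, u ≠ v ∧ ¬ H.Adj v u
  · obtain ⟨v, hv, hu⟩ := h
    obtain ⟨x, hx, -, -, hs⟩ := hH.exists_isSimplicialIn_not_adj W v hv hu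
    exact ⟨x, hx, hs⟩
  · push Not at h
    obtain ⟨x, hx⟩ := hW
    exact ⟨x, hx, fun a ha b hb _ _ hab => h a ha b hb (Ne.symm hab)⟩

end SimpleGraph

theorem SimpleGraph.coeff_pair_of_mem_edgeIdeal {V : Type*} {K : Type*} [Field K]
    {G : SimpleGraph V} {u w : V}
    (h : ¬ G.Adj u w) {p : MvPolynomial V K} (hp : p ∈ G.edgeIdeal K) :
    coeff (Finsupp.single u 1 + Finsupp.single w 1) p = 0 := by
  classical
  by_contra h0
  rw [← G.edgeIdealOn_univ] at hp
  obtain ⟨x, -, y, -, hxy, hx, hy⟩ :=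
    (G.isMonomialIdeal_edgeIdealOn Set.univ p).1 hp _ (mem_support_iff.2 h0)
  simp only [Finsupp.add_apply, Finsupp.single_apply] at hx hy
  have h1 := hxy.ne
  have h2 := hxy.symm
  have hx' : u = x ∨ w = x := by
    by_contra! hc
    simp [hc] at hx
  have hy' : u = y ∨ w = y := by
    by_contra! hc
    simp [hc] at hy
  grind

/-! ### An induced cycle of the complement gives nonzero Koszul homology -/

section Cycle

variable {V : Type*} [LinearOrder V] [Fintype V] {K : Type*} [Field K]

theorem coeff_koszulD_pair (h : Finset V → MvPolynomial V K) {S : Finset V} {u w : V}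
    (hu : u ∉ S) (hw : w ∉ S) (huw : u ≠ w) :
    coeff (Finsupp.single u 1 + Finsupp.single w 1) (koszulD K h S) =
      koszulSign u S * coeff (Finsupp.single w 1) (h (insert u S)) +
        koszulSign w S * coeff (Finsupp.single u 1) (h (insert w S)) := by
  rw [koszulD_apply, coeff_sum, Finset.sum_eq_add u w huw]
  · rw [coeff_smul, coeff_smul, smul_eq_mul, smul_eq_mul, zsmul_eq_mul, zsmul_eq_mul,
      coeff_X_mul, add_comm (Finsupp.single u 1), coeff_X_mul]
  · rintro v - ⟨hvu, hvw⟩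
    rw [coeff_smul, smul_eq_mul, coeff_X_mul', if_neg, smul_zero]
    simp [hvu.symm, hvw.symm]
  · exact fun h => absurd (Finset.mem_compl.2 hu) h
  · exact fun h => absurd (Finset.mem_compl.2 hw) h

/-- The signed coefficient of `X u ⊗ e_{W \ u}` in a Koszul chain. -/
noncomputable def koszulPotential (h : Finset V → MvPolynomial V K) (W : Finset V) (u : V) : K :=
  koszulSign u (W.erase u) * coeff (Finsupp.single u 1) (h (W.erase u))

/-- Only two terms of the differential contribute to `x_u x_w` at `W \ {u, w}`, and with the signs
normalised they give, up to sign, the difference of the two potentials. -/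
theorem koszulPotential_eq_iff (h : Finset V → MvPolynomial V K) {W : Finset V} {u w : V}
    (hu : u ∈ W) (hw : w ∈ W) (huw : u ≠ w) :
    koszulPotential h W u = koszulPotential h W w ↔
      coeff (Finsupp.single u 1 + Finsupp.single w 1)
        (koszulD K h ((W.erase u).erase w)) = 0 := by
  set S := (W.erase u).erase w with hS
  have huS : u ∉ S := by simp [hS]
  have hwS : w ∉ S := by simp [hS]
  have e1 : W.erase u = insert w S := by
    rw [hS, Finset.insert_erase (by simp [hw, huw.symm])]
  have e2 : W.erase w = insert u S := by
    rw [hS, Finset.erase_right_comm, Finset.insert_erase (by simp [hu, huw])]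
  rw [coeff_koszulD_pair h huS hwS huw, koszulPotential, koszulPotential, e1, e2,
    koszulSign_insert huS, koszulSign_insert hwS]
  have s1 : (koszulSign u S : K) * koszulSign u S = 1 := by
    exact_mod_cast congrArg (Int.cast : ℤ → K) (koszulSign_mul_self u S)
  have s2 : (koszulSign w S : K) * koszulSign w S = 1 := by
    exact_mod_cast congrArg (Int.cast : ℤ → K) (koszulSign_mul_self w S)
  generalize (koszulSign u S) = s at *
  generalize (koszulSign w S) = t at *
  generalize coeff (Finsupp.single w 1) (h (insert u S)) = A
  generalize coeff (Finsupp.single u 1) (h (insert w S)) = B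
  have key : (s : K) * A + t * B = 0 ↔ (t : K) * A + s * B = 0 := by
    constructor
    · intro h
      linear_combination (s : K) * t * h - t * A * s1 - s * B * s2
    · intro h
      linear_combination (s : K) * t * h - s * A * s2 - t * B * s1
  rw [key]
  rcases lt_or_gt_of_ne huw with hlt | hlt
  · rw [if_pos hlt, if_neg hlt.not_gt]
    push_cast
    constructor <;> intro h <;> linear_combination h
  · rw [if_neg hlt.not_gt, if_pos hlt]
    push_cast
    constructor <;> intro h <;> linear_combination -h

theorem SimpleGraph.not_koszulVanishing_of_cycle {G : SimpleGraph V} {n : ℕ} (hn : 4 ≤ n)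
    {q : ℕ → V} (hne : ∀ i j, i < j → j < n → q i ≠ q j)
    (hadj : ∀ i j, i < j → j < n → (Gᶜ.Adj (q i) (q j) ↔ j = i + 1 ∨ (i = 0 ∧ j + 1 = n))) :
    ¬ KoszulVanishing (DegreeProjection.poly K V) (G.edgeIdeal K) 2 := by
  intro hvan
  have hnadj : ∀ i j, i < j → j < n → (j = i + 1 ∨ (i = 0 ∧ j + 1 = n)) →
      ¬ G.Adj (q i) (q j) := fun i j hij hj h => ((compl_adj _ _ _).1 ((hadj i j hij hj).2 h)).2
  have hGadj : ∀ i j, i < j → j < n → ¬ (j = i + 1 ∨ (i = 0 ∧ j + 1 = n)) →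
      G.Adj (q i) (q j) := by
    intro i j hij hj h
    by_contra h'
    exact h ((hadj i j hij hj).1 ((compl_adj _ _ _).2 ⟨hne i j hij hj, h'⟩))
  let W : Finset V := (Finset.range n).image q
  have hW : ∀ i < n, q i ∈ W := fun i hi => Finset.mem_image_of_mem q (Finset.mem_range.2 hi)
  let T : Finset V := (W.erase (q 0)).erase (q 1)
  have hT : ∀ k, 2 ≤ k → k < n → q k ∈ T := fun k h2 hk =>
    Finset.mem_erase.2 ⟨(hne 1 k (by omega) hk).symm,
      Finset.mem_erase.2 ⟨(hne 0 k (by omega) hk).symm, hW k hk⟩⟩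
  -- The candidate class is `∂(x_{q 0} x_{q 1} e_T)`. The monomial itself is not in the edge ideal,
  -- but its product with any `x_{q k}`, `k ≥ 2`, is.
  let g : Finset V → MvPolynomial V K := fun S => if S = T then X (q 0) * X (q 1) else 0
  have hgd : ∀ S, (DegreeProjection.poly K V).proj 2 (g S) = g S := by
    intro S
    simp only [g]
    split_ifs
    · rw [DegreeProjection.poly_proj, X, X, monomial_mul, polyProj_monomial, if_pos]
      simp
    · exact map_zero _
  have hcI : ∀ S, koszulD K g S ∈ G.edgeIdeal K := by
    intro S
    rw [koszulD_apply]
    refine Submodule.sum_mem _ fun v hv => zsmul_mem ?_ _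
    simp only [g]
    split_ifs with hvT
    · have hvT' : v ∈ T := hvT ▸ Finset.mem_insert_self v S
      obtain ⟨hv1, hv⟩ := Finset.mem_erase.1 hvT'
      obtain ⟨hv0, hv⟩ := Finset.mem_erase.1 hv
      obtain ⟨k, hk, rfl⟩ := Finset.mem_image.1 hv
      rw [Finset.mem_range] at hk
      have hk0 : k ≠ 0 := fun h => hv0 (by rw [h])
      have hk1 : k ≠ 1 := fun h => hv1 (by rw [h])
      -- As `n ≥ 4`, on the cycle `q 2` is not next to `q 0`, and `q k` with `k ≥ 3` is not next to
      -- `q 1`; these pairs are edges of `G`.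
      by_cases hk2 : k = 2
      · have : (X (q k) : MvPolynomial V K) * X (q 0) ∈ G.edgeIdeal K :=
          Ideal.subset_span ⟨_, _, (hGadj 0 k (by omega) hk (by omega)).symm, rfl⟩
        rw [smul_eq_mul, ← mul_assoc]
        exact Ideal.mul_mem_right _ _ this
      · have : (X (q k) : MvPolynomial V K) * X (q 1) ∈ G.edgeIdeal K :=
          Ideal.subset_span ⟨_, _, (hGadj 1 k (by omega) hk (by omega)).symm, rfl⟩
        rw [smul_eq_mul, mul_left_comm]
        exact Ideal.mul_mem_left _ _ this
    · rw [smul_zero]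
      exact zero_mem _
  have hstable : (DegreeProjection.poly K V).Stable (G.edgeIdeal K) := by
    rw [← G.edgeIdealOn_univ]
    exact (G.isMonomialIdeal_edgeIdealOn _).stable
  obtain ⟨b, hbI, hb⟩ := hvan (2 + 1) (by norm_num) _ hcI (proj_koszulD hgd) (koszulD_koszulD K g)
  obtain ⟨b, hbI, hbd, hb⟩ := exists_homogeneous_preimage hstable hbI (proj_koszulD hgd) hb
  rw [add_sub_cancel_right] at hbd
  obtain ⟨h, hh⟩ := exists_koszulD_eq_of_degree_pos K (d := 2) (by norm_num) (c := g - b)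
    (fun S => by
      rw [Pi.sub_apply, map_sub]
      exact congrArg₂ (· - ·) (hgd S) (hbd S))
    (by rw [map_sub, hb, sub_self])
  -- Cycle edges are non-edges of `G`, so `b` contributes nothing there; `2 ≤ j` excludes exactly
  -- the edge from `q 0` to `q 1`, where `g` lives.
  have hstep : ∀ i j, i < j → j < n → 2 ≤ j → (j = i + 1 ∨ (i = 0 ∧ j + 1 = n)) →
      koszulPotential h W (q i) = koszulPotential h W (q j) := by
    intro i j hij hj h2 hor
    rw [koszulPotential_eq_iff h (hW i (by omega)) (hW j hj) (hne i j hij hj), hh,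
      Pi.sub_apply, coeff_sub, coeff_pair_of_mem_edgeIdeal (hnadj i j hij hj hor) (hbI _), sub_zero]
    simp only [g]
    rw [if_neg, coeff_zero]
    intro hST
    have := hT j h2 hj
    rw [← hST] at this
    simp at this
  have hchain : ∀ k, 1 ≤ k → k < n → koszulPotential h W (q 1) = koszulPotential h W (q k) := by
    intro k hk
    induction k, hk using Nat.le_induction with
    | base => exact fun _ => rfl
    | succ k hk ih =>
      intro hkn
      exact (ih (by omega)).trans (hstep k (k + 1) (by omega) hkn (by omega) (Or.inl rfl))
  -- Going the long way around the cycle equates the potentials at `q 0` and `q 1`, whereas the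
  -- coefficient 1 of `g` forces them to differ.
  have h01 : koszulPotential h W (q 0) = koszulPotential h W (q 1) :=
    (hstep 0 (n - 1) (by omega) (by omega) (by omega) (Or.inr ⟨rfl, by omega⟩)).trans
      (hchain (n - 1) (by omega) (by omega)).symm
  rw [koszulPotential_eq_iff h (hW 0 (by omega)) (hW 1 (by omega)) (hne 0 1 (by omega) (by omega)),
    hh, Pi.sub_apply, coeff_sub,
    coeff_pair_of_mem_edgeIdeal (hnadj 0 1 (by omega) (by omega) (Or.inl rfl)) (hbI _),
    sub_zero] at h01
  simp [g, T, X, monomial_mul] at h01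

theorem SimpleGraph.isChordalGraph_compl_of_koszulVanishing {G : SimpleGraph V}
    (h : KoszulVanishing (DegreeProjection.poly K V) (G.edgeIdeal K) 2) : Gᶜ.IsChordalGraph := by
  rintro n hn ⟨f⟩
  let q : ℕ → V := fun k => f ⟨k % n, Nat.mod_lt k (by omega)⟩
  have hq : ∀ k (hk : k < n), q k = f ⟨k, hk⟩ := fun k hk =>
    congrArg f (Fin.ext (Nat.mod_eq_of_lt hk))
  refine not_koszulVanishing_of_cycle hn (q := q) ?_ ?_ h
  · intro i j hij hj
    rw [hq i (by omega), hq j hj]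
    exact fun heq => hij.ne (congrArg Fin.val (f.injective heq))
  · intro i j hij hj
    rw [hq i (by omega), hq j hj, f.map_adj_iff]
    exact cycleGraph_adj_of_lt hij

end Cycle

/-! ### Conclusion: the two directions -/

theorem SimpleGraph.IsChordalGraph.koszulVanishing_edgeIdeal {V : Type*} [LinearOrder V]
    [Fintype V] (K : Type*) [Field K] {G : SimpleGraph V} (h : Gᶜ.IsChordalGraph) :
    KoszulVanishing (DegreeProjection.poly K V) (G.edgeIdeal K) 2 := by
  have := G.koszulVanishing_edgeIdealOn (K := K) (fun W hW => h.exists_isSimplicialIn hW)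
    Finset.univ
  rwa [Finset.coe_univ, G.edgeIdealOn_univ] at this

/-- By minimality a basis element maps to a nonzero element of the ideal, and each of its monomials
is divisible by an edge. The edge of `G` only ensures that a basis element exists. -/
theorem SimpleGraph.exists_deg_zero_ge_two {V : Type*} {K : Type*} [Field K] {G : SimpleGraph V}
    (hG : G ≠ ⊥) (F : MinimalGradedFreeResolution (V := V) (idealPart (G.edgeIdeal K))) :
    ∃ a, 2 ≤ F.deg 0 a := by
  classical
  have hI := G.isMonomialIdeal_edgeIdealOn (K := K) Set.univ
  rw [G.edgeIdealOn_univ] at hI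
  obtain ⟨u, v, huv⟩ := ne_bot_iff_exists_adj.1 hG
  have hmem : (X u * X v : MvPolynomial V K) ∈ G.edgeIdeal K := Ideal.subset_span ⟨u, v, huv, rfl⟩
  obtain ⟨f, hf⟩ := F.aug_surjective ⟨_, hmem⟩
  have hf0 : f ≠ 0 := by
    rintro rfl
    rw [map_zero] at hf
    exact mul_ne_zero (X_ne_zero u) (X_ne_zero v) (congrArg Subtype.val hf).symm
  obtain ⟨a, -⟩ := Function.ne_iff.1 hf0
  refine ⟨a, ?_⟩
  have hne : F.augPoly (Pi.single a 1) ≠ 0 := by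
    intro h0
    simpa using F.constantCoeff_of_augPoly_eq_zero _ h0 a
  obtain ⟨m, hm⟩ := support_nonempty.2 hne
  obtain ⟨x, -, y, -, hxy, hx, hy⟩ := (hI _).1 (F.aug (Pi.single a 1)).2 m hm
  rw [← F.proj_augPoly_single, DegreeProjection.poly_proj, mem_support_iff, coeff_polyProj] at hm
  have hd : (m.degree : ℤ) = F.deg 0 a := by
    by_contra h
    rw [if_neg h] at hm
    exact hm rfl
  have hle : Finsupp.single x 1 + Finsupp.single y 1 ≤ m := by
    intro z
    have := hxy.ne
    simp only [Finsupp.add_apply, Finsupp.single_apply]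
    split_ifs <;> grind
  have := Finsupp.degree_mono hle
  simp only [map_add, Finsupp.degree_single] at this
  omega

theorem mainTheorem2 {K : Type*} [Field K] {V : Type*} [Finite V] (G : SimpleGraph V)
    (hG : G ≠ ⊥) :
    regularity V (idealPart (G.edgeIdeal K)) = 2 ↔ Gᶜ.IsChordalGraph := by
  have := Fintype.ofFinite V
  -- The order is arbitrary; it only fixes the Koszul signs.
  let : LinearOrder V := IsWellOrder.linearOrder WellOrderingRel
  have hstable : (DegreeProjection.poly K V).Stable (G.edgeIdeal K) := by
    rw [← G.edgeIdealOn_univ]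
    exact (G.isMonomialIdeal_edgeIdealOn _).stable
  have hle : ∀ x : ℤ, ((x : WithTop ℤ) : WithBot (WithTop ℤ)) ≤ 2 ↔ x ≤ 2 := by
    intro x
    rw [show (2 : WithBot (WithTop ℤ)) = (((2 : ℤ) : WithTop ℤ) : WithBot (WithTop ℤ)) from rfl,
      WithBot.coe_le_coe, WithTop.coe_le_coe]
  have hbetti : ∀ (F : MinimalGradedFreeResolution (V := V) (idealPart (G.edgeIdeal K))) i a,
      F.betti i (F.deg i a) ≠ 0 := by
    intro F i a
    rw [MinimalGradedFreeResolution.betti, Finset.card_ne_zero]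
    exact ⟨a, by simp⟩
  unfold regularity
  constructor
  · intro h
    -- The supremum bounds degrees only in resolutions that exist, so one has to be produced.
    have hnonempty : Nonempty (MinimalGradedFreeResolution (V := V)
        (idealPart (G.edgeIdeal K))) := exists_minimalGradedFreeResolution hstable
    obtain ⟨F⟩ := hnonempty
    refine SimpleGraph.isChordalGraph_compl_of_koszulVanishing
      (F.koszulVanishing_of_deg_le fun i a => ?_)
    have : F.deg i a - i ≤ 2 := by
      rw [← hle, ← h]
      exact le_sSup ⟨F, i, _, hbetti F i a, rfl⟩
    linarith
  · intro h
    have hvan := h.koszulVanishing_edgeIdeal K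
    apply le_antisymm
    · refine sSup_le ?_
      rintro _ ⟨F, i, j, hij, rfl⟩
      rw [hle]
      rw [MinimalGradedFreeResolution.betti, Finset.card_ne_zero] at hij
      obtain ⟨a, ha⟩ := hij
      have := F.deg_le hvan i a
      rw [← (Finset.mem_filter.1 ha).2]
      linarith
    · obtain ⟨F⟩ := exists_minimalGradedFreeResolution hstable
      obtain ⟨a, ha⟩ := SimpleGraph.exists_deg_zero_ge_two hG F
      have h2 := F.deg_le hvan 0 a
      refine le_sSup ⟨F, 0, F.deg 0 a, hbetti F 0 a, ?_⟩
      have : F.deg 0 a - (0 : ℕ) = 2 := by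
        push_cast at h2 ⊢
        omega
      rw [this]
      rfl
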